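/- Theorem 3.4. Let $k\ge 1$ and $n>k+2$, and let $\Gamma_k\subset\mathbb{R}^n$ be a compact smooth $k$-dimensional embedded submanifold, with or without boundary. For $x\in\Gamma_k$ let $N(x)$ be the orthogonal complement of the tangent space of $\Gamma_k$ at $x$, and for $\varepsilon>0$ let $T_\varepsilon(\Gamma_k)$ be the interior of the set $\bigcup_{x\in\Gamma_k}\{x+\xi : \xi\in N(x),\ |\xi|<\varepsilon\}$. Let $f:\mathbb{R}\to\mathbb{R}$ be continuous, put $F(t)=\int_0^t f(\tau)\,d\tau$, and suppose that $$t f(t)\ \ge\ p\,F(t)\ \ge\ 0\qquad\text{for all } t\in\mathbb{R},$$ for some real $p>\frac{2(n-k)}{n-k-2}$. Then there exists $\bar\varepsilon>0$ such that for every $\varepsilon\in(0,\bar\varepsilon)$ the Dirichlet problem $$\Delta u+f(u)=0\ \text{ in }\Omega,\qquad u=0\ \text{ on }\partial\Omega,\qquad \Omega=T_\varepsilon(\Gamma_k),$$ has the trivial solution $u\equiv 0$ and no other solution $u\in C^2(\Omega)\cap C(\overline\Omega)$. No topological assumption is made on $\Gamma_k$; in particular it may or may not be contractible. -/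

import Mathlib

open scoped ContDiff

noncomputable section

/-- The coordinate subspace `ℝᵏ × {0}` of `ℝⁿ`. -/
def flatModel (n k : ℕ) : Set (EuclideanSpace ℝ (Fin n)) :=
  {y | ∀ i : Fin n, k ≤ (i : ℕ) → y i = 0}

/-- The half-space `{y ∈ ℝᵏ × {0} | y₀ ≥ 0}` of the coordinate subspace `ℝᵏ × {0}` of `ℝⁿ`. -/
def flatHalfModel (n k : ℕ) : Set (EuclideanSpace ℝ (Fin n)) :=
  {y | y ∈ flatModel n k ∧ ∀ i : Fin n, (i : ℕ) = 0 → 0 ≤ y i}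

/-- `Γ ⊆ ℝⁿ` is a smooth (`C^∞`) embedded `k`-dimensional submanifold, possibly with boundary:
around each of its points there is a smooth diffeomorphism `Φ` between open subsets of `ℝⁿ`
that carries `Γ` to `ℝᵏ × {0}` or to a half-space of it. -/
def IsSmoothSubmanifold (n k : ℕ) (Γ : Set (EuclideanSpace ℝ (Fin n))) : Prop :=
  ∀ x ∈ Γ, ∃ Φ : OpenPartialHomeomorph (EuclideanSpace ℝ (Fin n)) (EuclideanSpace ℝ (Fin n)),
    x ∈ Φ.source ∧
    ContDiffOn ℝ ∞ Φ Φ.source ∧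
    ContDiffOn ℝ ∞ Φ.symm Φ.target ∧
    ((∀ y ∈ Φ.source, y ∈ Γ ↔ Φ y ∈ flatModel n k) ∨
      (∀ y ∈ Φ.source, y ∈ Γ ↔ Φ y ∈ flatHalfModel n k))

/-- The tangent space `T(x)` of `Γ ⊆ ℝⁿ` at `x`: the linear span of the limits of secant vectors.
(For a point in the boundary of `Γ` the limits of secants only fill a half-space of `T(x)`.) -/
def tangentSpaceAt {n : ℕ} (Γ : Set (EuclideanSpace ℝ (Fin n))) (x : EuclideanSpace ℝ (Fin n)) :
    Submodule ℝ (EuclideanSpace ℝ (Fin n)) :=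
  Submodule.span ℝ (tangentConeAt ℝ Γ x)

/-- The normal space `N(x) = T(x)^⊥`. -/
def normalSpaceAt {n : ℕ} (Γ : Set (EuclideanSpace ℝ (Fin n))) (x : EuclideanSpace ℝ (Fin n)) :
    Submodule ℝ (EuclideanSpace ℝ (Fin n)) :=
  (tangentSpaceAt Γ x)ᗮ

/-- The tubular domain `T_ε(Γ)`: the interior of `⋃ x ∈ Γ, x + N_ε(x)`, where
`N_ε(x) = {ξ ∈ N(x) | |ξ| < ε}`. -/
def tubularDomain {n : ℕ} (ε : ℝ) (Γ : Set (EuclideanSpace ℝ (Fin n))) :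
    Set (EuclideanSpace ℝ (Fin n)) :=
  interior (⋃ x ∈ Γ, {z | ∃ ξ ∈ normalSpaceAt Γ x, ‖ξ‖ < ε ∧ z = x + ξ})

/-- `u` is a (classical) solution of the Dirichlet problem `Δu + f(u) = 0` in the open set `Ω`,
`u = 0` on `∂Ω`: it is `C²` in `Ω` and continuous on the closure of `Ω`.
Only the values of `u` on the closure of `Ω` matter. -/
structure IsDirichletSolution {n : ℕ} (f : ℝ → ℝ) (Ω : Set (EuclideanSpace ℝ (Fin n)))
    (u : EuclideanSpace ℝ (Fin n) → ℝ) : Prop where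
  contDiffOn : ContDiffOn ℝ 2 u Ω
  continuousOn : ContinuousOn u (closure Ω)
  equation : ∀ x ∈ Ω, Laplacian.laplacian u x + f (u x) = 0
  boundary : ∀ x ∈ frontier Ω, u x = 0

end

section

open scoped ContDiff Topology Gradient
open MeasureTheory Set Filter

/-! ### Weak form of the equation and the gradient on the zero set. -/

section Analysis

variable {E : Type*} [NormedAddCommGroup E] [InnerProductSpace ℝ E]

/-! The proof is a Pohozaev argument in the form of a one-sided inner variation, so it needs no
regularity of the boundary of the tube `Ω`, nor of `∇u` near it. In a thin tube let `h(z)` be the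
displacement of `z` from the foot of its normal. The derivative of `h` is within `η` of an
orthogonal projection of rank `m = n - k`: its trace is close to `m`, and its quadratic form hardly
exceeds `|v|²`. Contraction along `h` maps the tube into itself, which plays the role of
star-shapedness and gives the boundary term its sign. The field is built in `exists_isRadialField`
from local projections supplied by the implicit function theorem; compactness of `Γ` makes them
uniform.

Extend `u` by zero and, for `s ≥ 0`, put `u_s(z) = u(z + s h(z))`, `D = ∫ |∇u|²`, `Φ = ∫ F(u)`.
Testing the equation with truncations of `u` and of `u_s` gives `D = ∫ f(u) u` and `∫ f(u) u_s ≤ ½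
(D + ∫ |∇u_s|²)`. A change of variables gives, up to errors of size `η s` and `s²`, `∫ |∇u_s|² ≤ (1
+ (2 - m) s) D` and, since `F ≥ 0`, `∫ F(u_s) ≥ (1 - m s) Φ`. As `F(u_s) - F(u) = f(u)(u_s - u) +
o(|u_s - u|)` uniformly and `∫ |u_s - u| = O(s)`, dividing by `s` and letting `s → 0` yields `-m Φ ≤
½ (2 - m) D`, up to `η`.

Integrating `p F(u) ≤ u f(u)` gives `p Φ ≤ D`, so `0 ≤ (1 - m/2 + m/p) D` up to `η`. The bracket is
negative exactly when `p > 2m/(m - 2)`; hence `D = 0` and `u` vanishes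
(`IsRadialField.solution_eq_zero`). -/

theorem contDiff_of_eq_zero_off_compact {w : E → ℝ} {U K : Set E} (hU : IsOpen U)
    (hK : IsCompact K) (hKU : K ⊆ U) (hw : ContDiffOn ℝ 1 w U) (h0 : ∀ x ∉ K, w x = 0) :
    ContDiff ℝ 1 w := by
  rw [contDiff_iff_contDiffAt]
  intro x
  by_cases hx : x ∈ K
  · exact hw.contDiffAt (hU.mem_nhds (hKU hx))
  · have : w =ᶠ[𝓝 x] fun _ => 0 := by
      filter_upwards [hK.isClosed.isOpen_compl.mem_nhds hx] with y hy using h0 y hy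
    exact contDiffAt_const.congr_of_eventuallyEq this

theorem fderiv_eq_zero_off_compact {w : E → ℝ} {K : Set E}
    (hK : IsCompact K) (h0 : ∀ x ∉ K, w x = 0) {x : E} (hx : x ∉ K) : fderiv ℝ w x = 0 := by
  have : w =ᶠ[𝓝 x] fun _ => 0 := by
    filter_upwards [hK.isClosed.isOpen_compl.mem_nhds hx] with y hy using h0 y hy
  rw [this.fderiv_eq]; simp

variable [FiniteDimensional ℝ E] [MeasurableSpace E] [BorelSpace E] (μ : Measure E) [μ.IsAddHaarMeasure]

theorem integral_fderiv_apply_eq_zero {X : E → ℝ} (hX : ContDiff ℝ 1 X)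
    (hc : HasCompactSupport X) (v : E) : ∫ x, fderiv ℝ X x v ∂μ = 0 := by
  have hcont : Continuous fun x => fderiv ℝ X x v :=
    (hX.continuous_fderiv one_ne_zero).clm_apply continuous_const
  have hcs : HasCompactSupport fun x => fderiv ℝ X x v := hc.fderiv_apply (𝕜 := ℝ) v
  have h := integral_mul_fderiv_eq_neg_fderiv_mul_of_integrable (μ := μ) (f := fun _ : E => (1 : ℝ))
    (g := X) (v := v) (by simp) (by simpa using hcont.integrable_of_hasCompactSupport hcs)
    (by simpa using hX.continuous.integrable_of_hasCompactSupport hc)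
    (fun x _ => by fun_prop) (fun x _ => (hX.differentiable one_ne_zero) x)
  simpa using h

/-- The weak form of `Δu + f(u) = 0`, tested with a compactly supported `C¹` function. -/
theorem integral_fderiv_gradient_eq {Ω K : Set E} (hΩ : IsOpen Ω) {u : E → ℝ} {f : ℝ → ℝ}
    (hu : ContDiffOn ℝ 2 u Ω) (hf : Continuous f)
    (heq : ∀ x ∈ Ω, Laplacian.laplacian u x + f (u x) = 0) {w : E → ℝ} (hw : ContDiff ℝ 1 w)
    (hK : IsCompact K) (hKΩ : K ⊆ Ω) (h0 : ∀ x ∉ K, w x = 0) :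
    ∫ x in Ω, fderiv ℝ w x (∇ u x) ∂μ = ∫ x in Ω, f (u x) * w x ∂μ := by
  let b := stdOrthonormalBasis ℝ E
  have hw0 : ∀ x ∉ K, fderiv ℝ w x = 0 := fun x hx => fderiv_eq_zero_off_compact hK h0 hx
  have hdu : ContDiffOn ℝ 1 (fderiv ℝ u) Ω := hu.fderiv_of_isOpen hΩ (by norm_num)
  -- The components of `w ∇u` vanish off `K`, hence are `C¹` on the whole space although `u` is
  -- regular only in `Ω`. The integral of the divergence of `w ∇u` is then zero.
  have hX : ∀ i, ContDiff ℝ 1 fun x => w x * fderiv ℝ u x (b i) := fun i =>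
    contDiff_of_eq_zero_off_compact hΩ hK hKΩ
      (hw.contDiffOn.mul (hdu.clm_apply contDiffOn_const)) (fun x hx => by simp [h0 x hx])
  have hXs : ∀ i, HasCompactSupport fun x => w x * fderiv ℝ u x (b i) := fun i =>
    HasCompactSupport.intro hK (fun x hx => by simp [h0 x hx])
  have hint : ∀ i, Integrable (fun x => fderiv ℝ (fun x => w x * fderiv ℝ u x (b i)) x (b i)) μ :=
    fun i => (((hX i).continuous_fderiv one_ne_zero).clm_apply
      continuous_const).integrable_of_hasCompactSupport ((hXs i).fderiv_apply (𝕜 := ℝ) _)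
  have hsum : ∫ x, ∑ i, fderiv ℝ (fun x => w x * fderiv ℝ u x (b i)) x (b i) ∂μ = 0 := by
    rw [integral_finsetSum _ fun i _ => hint i]
    exact Finset.sum_eq_zero fun i _ => integral_fderiv_apply_eq_zero μ (hX i) (hXs i) _
  have hpt : ∀ x, ∑ i, fderiv ℝ (fun x => w x * fderiv ℝ u x (b i)) x (b i)
      = fderiv ℝ w x (∇ u x) - f (u x) * w x := by
    intro x
    by_cases hx : x ∈ K
    · have hxΩ := hΩ.mem_nhds (hKΩ hx)
      have hd : DifferentiableAt ℝ (fderiv ℝ u) x :=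
        (hdu.contDiffAt hxΩ).differentiableAt one_ne_zero
      have hwd : DifferentiableAt ℝ w x := (hw.differentiable one_ne_zero) x
      have h1 : ∀ i, fderiv ℝ (fun x => w x * fderiv ℝ u x (b i)) x (b i)
          = w x * fderiv ℝ (fderiv ℝ u) x (b i) (b i)
            + fderiv ℝ u x (b i) * fderiv ℝ w x (b i) := by
        intro i
        rw [fderiv_fun_mul hwd (hd.clm_apply (differentiableAt_const _)),
          fderiv_clm_apply hd (differentiableAt_const _)]
        simp
      have h2 : Laplacian.laplacian u x = ∑ i, fderiv ℝ (fderiv ℝ u) x (b i) (b i) := by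
        rw [InnerProductSpace.laplacian_eq_iteratedFDeriv_orthonormalBasis u b]
        simp [iteratedFDeriv_two_apply]
      have h3 : ∇ u x = ∑ i, fderiv ℝ u x (b i) • b i := by
        rw [← b.sum_repr (∇ u x)]
        refine Finset.sum_congr rfl fun i _ => ?_
        rw [b.repr_apply_apply, real_inner_comm, gradient]
        simp
      simp only [h1, Finset.sum_add_distrib, ← Finset.mul_sum, ← h2]
      have := heq x (hKΩ hx)
      rw [h3, map_sum]
      simp only [map_smul, smul_eq_mul]
      have h4 : Laplacian.laplacian u x = - f (u x) := by linarith
      rw [h4]; ring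
    · have : ∀ i, fderiv ℝ (fun x => w x * fderiv ℝ u x (b i)) x = 0 := fun i =>
        fderiv_eq_zero_off_compact hK (fun x hx => by simp [h0 x hx]) hx
      simp [this, hw0 x hx, h0 x hx]
  simp_rw [hpt] at hsum
  have hc1 : ContinuousOn (fun x => fderiv ℝ w x (∇ u x)) K := by
    refine ContinuousOn.clm_apply (hw.continuous_fderiv one_ne_zero).continuousOn ?_
    exact (InnerProductSpace.toDual ℝ E).symm.continuous.comp_continuousOn
      (hdu.continuousOn.mono hKΩ)
  have hc2 : ContinuousOn (fun x => f (u x) * w x) K :=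
    (hf.comp_continuousOn (hu.continuousOn.mono hKΩ)).mul hw.continuous.continuousOn
  have e1 : ∀ G : E → ℝ, (∀ x ∉ K, G x = 0) → ContinuousOn G K →
      Integrable G μ ∧ ∫ x in Ω, G x ∂μ = ∫ x, G x ∂μ := by
    intro G hG hGc
    refine ⟨?_, setIntegral_eq_integral_of_forall_compl_eq_zero
      fun x hx => hG x fun h => hx (hKΩ h)⟩
    rw [← integrableOn_iff_integrable_of_support_subset (s := K)]
    · exact hGc.integrableOn_compact hK
    · intro x hx; by_contra h; exact hx (hG x h)
  obtain ⟨i1, j1⟩ := e1 (fun x => fderiv ℝ w x (∇ u x)) (fun x hx => by simp [hw0 x hx]) hc1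
  obtain ⟨i2, j2⟩ := e1 (fun x => f (u x) * w x) (fun x hx => by simp [h0 x hx]) hc2
  rw [integral_sub i1 i2] at hsum
  rw [j1, j2]; linarith

/-- The gradient of a `C¹` function vanishes almost everywhere on its zero set. -/
theorem ae_fderiv_eq_zero_of_eq_zero {Ω : Set E} (hΩ : IsOpen Ω) {u : E → ℝ} (huc : Continuous u)
    (hu : DifferentiableOn ℝ u Ω) : ∀ᵐ x ∂μ, x ∈ Ω → u x = 0 → fderiv ℝ u x = 0 := by
  let b := stdOrthonormalBasis ℝ E
  have key : ∀ v : E, ∀ᵐ x ∂μ, x ∈ Ω → u x = 0 → fderiv ℝ u x v = 0 := by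
    intro v
    have hmeas : MeasurableSet {x | x ∈ Ω → u x = 0 → fderiv ℝ u x v = 0} := by
      have : {x | x ∈ Ω → u x = 0 → fderiv ℝ u x v = 0}
          = (Ω ∩ u ⁻¹' {0} ∩ (fun x => fderiv ℝ u x v) ⁻¹' {0}ᶜ)ᶜ := by
        ext x; simp only [mem_ofPred_eq, mem_compl_iff, mem_inter_iff, mem_preimage,
          mem_singleton_iff]; tauto
      rw [this]
      exact ((hΩ.measurableSet.inter (huc.measurable (measurableSet_singleton 0))).inter
        ((measurable_fderiv_apply_const ℝ u v) (measurableSet_singleton 0).compl)).compl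
    -- Fubini along lines parallel to `v`: where `u = 0` and the derivative along the line is
    -- nonzero, the zero is isolated, so the exceptional set meets each line in a null set.
    refine ae_mem_of_ae_add_linearMap_mem ((LinearMap.id : ℝ →ₗ[ℝ] ℝ).smulRight v) volume μ
      hmeas fun y => ?_
    rw [ae_iff]
    refine measure_null_of_locally_null _ fun t ht => ?_
    replace ht : ¬ (y + t • v ∈ Ω → u (y + t • v) = 0 → fderiv ℝ u (y + t • v) v = 0) := ht
    simp only [Classical.not_imp] at ht
    obtain ⟨h1, h2, h3⟩ := ht
    have hd : HasDerivAt (fun t : ℝ => u (y + t • v)) (fderiv ℝ u (y + t • v) v) t := by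
      have h4 := ((hu _ h1).differentiableAt (hΩ.mem_nhds h1)).hasFDerivAt
      have h5 : HasDerivAt (fun t : ℝ => y + t • v) v t := by
        simpa using ((hasDerivAt_id t).smul_const v).const_add y
      exact h4.comp_hasDerivAt t h5
    refine ⟨{t}, ?_, by simp⟩
    have h6 := hd.eventually_ne (c := 0) h3
    rw [eventually_nhdsWithin_iff] at h6
    rw [mem_nhdsWithin_iff_eventually]
    filter_upwards [h6] with r hr hr'
    replace hr' : ¬ (y + r • v ∈ Ω → u (y + r • v) = 0 → fderiv ℝ u (y + r • v) v = 0) := hr'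
    simp only [Classical.not_imp] at hr'
    by_contra hne
    exact hr hne hr'.2.1
  have : ∀ᵐ x ∂μ, ∀ i, x ∈ Ω → u x = 0 → fderiv ℝ u x (b i) = 0 := ae_all_iff.2 fun i => key _
  filter_upwards [this] with x hx h1 h2
  refine ContinuousLinearMap.coe_injective (b.toBasis.ext fun i => ?_)
  simpa using hx i h1 h2

end Analysis

/-! ### First order expansion of the determinant. -/

section Det

variable {E : Type*} [NormedAddCommGroup E] [NormedSpace ℝ E] [FiniteDimensional ℝ E]

theorem differentiableAt_det (A : E →L[ℝ] E) :
    DifferentiableAt ℝ (fun B : E →L[ℝ] E => B.det) A := by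
  let b := Module.finBasis ℝ E
  have : (fun B : E →L[ℝ] E => B.det)
      = fun B : E →L[ℝ] E => (LinearMap.toMatrix b b (B : E →ₗ[ℝ] E)).det := by
    funext B; rw [LinearMap.det_toMatrix]
  rw [this]
  have hL : ∀ i j, ContDiff ℝ 1 fun B : E →L[ℝ] E =>
      LinearMap.toMatrix b b (B : E →ₗ[ℝ] E) i j := by
    intro i j
    let L : (E →L[ℝ] E) →ₗ[ℝ] ℝ :=
      { toFun := fun B => LinearMap.toMatrix b b (B : E →ₗ[ℝ] E) i j
        map_add' := by intro x y; simp [LinearMap.toMatrix_apply]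
        map_smul' := by intro x y; simp [LinearMap.toMatrix_apply] }
    exact (LinearMap.toContinuousLinearMap L).contDiff
  simp only [Matrix.det_apply]
  have h : ContDiff ℝ 1 fun B : E →L[ℝ] E => ∑ σ : Equiv.Perm (Fin (Module.finrank ℝ E)),
      Equiv.Perm.sign σ • ∏ i, LinearMap.toMatrix b b (B : E →ₗ[ℝ] E) (σ i) i :=
    ContDiff.sum fun σ _ => (contDiff_prod fun i _ => hL (σ i) i).const_smul _
  exact h.differentiable one_ne_zero A

theorem hasDerivAt_det_one_add_smul (A : E →L[ℝ] E) :
    HasDerivAt (fun s : ℝ => (1 + s • A).det) (LinearMap.trace ℝ E A) 0 := by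
  let b := Module.finBasis ℝ E
  let M := LinearMap.toMatrix b b (A : E →ₗ[ℝ] E)
  have h : ∀ s : ℝ, (1 + s • A).det = (1 + s • M).det := by
    intro s
    have : (1 + s • M) = LinearMap.toMatrix b b ((1 + s • A : E →L[ℝ] E) : E →ₗ[ℝ] E) := by
      simp [M, LinearMap.toMatrix_one]
    rw [this, LinearMap.det_toMatrix]
  have ht : LinearMap.trace ℝ E A = M.trace := LinearMap.trace_eq_matrix_trace ℝ b _
  have he : (fun s : ℝ => (1 + s • A).det) = fun s => 1 + M.trace * s + _ :=
    funext fun s => (h s).trans (Matrix.det_one_add_smul s M)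
  rw [he, ht]
  have h1 : HasDerivAt (fun s : ℝ => 1 + M.trace * s) M.trace 0 := by
    simpa using ((hasDerivAt_id (0:ℝ)).const_mul M.trace).const_add 1
  refine HasDerivAt.congr_deriv (h1.add ((Polynomial.hasDerivAt _ _).mul (hasDerivAt_pow 2 0))) ?_
  simp

theorem hasFDerivAt_det_one :
    HasFDerivAt (fun B : E →L[ℝ] E => B.det) (fderiv ℝ (fun B : E →L[ℝ] E => B.det) 1) 1 ∧
    ∀ A, fderiv ℝ (fun B : E →L[ℝ] E => B.det) 1 A = LinearMap.trace ℝ E A := by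
  refine ⟨(differentiableAt_det 1).hasFDerivAt, fun A => ?_⟩
  have h1 : HasDerivAt (fun s : ℝ => (1 : E →L[ℝ] E) + s • A) A 0 := by
    simpa using ((hasDerivAt_id (0:ℝ)).smul_const A).const_add 1
  have h2 : HasFDerivAt (fun B : E →L[ℝ] E => B.det)
      (fderiv ℝ (fun B : E →L[ℝ] E => B.det) 1) (1 + (0:ℝ) • A) := by
    simpa using (differentiableAt_det 1).hasFDerivAt
  have h3 := HasFDerivAt.comp_hasDerivAt (l := fun B : E →L[ℝ] E => B.det) 0 h2 h1
  exact h3.unique (hasDerivAt_det_one_add_smul A)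

/-- Differentiability of `det` at the identity is with respect to the operator norm, so the
remainder is controlled by `‖s A‖ ≤ s C` alone, uniformly in `A`. This is applied to all values of
the derivative of `h` at once. -/
theorem exists_abs_det_one_add_smul_sub_le {C η : ℝ} (hC : 0 < C) (hη : 0 < η) :
    ∃ s₀ > 0, ∀ s : ℝ, 0 ≤ s → s ≤ s₀ → ∀ A : E →L[ℝ] E, ‖A‖ ≤ C →
      |(1 + s • A).det - (1 + s * LinearMap.trace ℝ E A)| ≤ η * s := by
  obtain ⟨hd, htr⟩ := hasFDerivAt_det_one (E := E)
  have h1 := hd.isLittleO.def (div_pos hη hC)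
  rw [Metric.eventually_nhds_iff] at h1
  obtain ⟨r, hr, h⟩ := h1
  refine ⟨r / (2 * C), by positivity, fun s hs0 hs A hA => ?_⟩
  have hsA : ‖s • A‖ ≤ s * C := by
    rw [norm_smul, Real.norm_of_nonneg hs0]; gcongr
  have hs' : s * C ≤ r / 2 := by
    rw [le_div_iff₀ (by positivity)] at hs ⊢; linarith
  have h2 := @h (1 + s • A) (by rw [dist_eq_norm, add_sub_cancel_left]; linarith)
  rw [add_sub_cancel_left, map_smul, htr, Real.norm_eq_abs, smul_eq_mul] at h2
  have h3 : (1 : E →L[ℝ] E).det = 1 := by simp [ContinuousLinearMap.det]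
  rw [h3] at h2
  calc _ = |(1 + s • A).det - 1 - s * LinearMap.trace ℝ E A| := by congr 1; ring
    _ ≤ η / C * ‖s • A‖ := h2
    _ ≤ η / C * (s * C) := by gcongr
    _ = η * s := by field_simp

end Det

end

/-! ### Truncations and radial fields. -/

section

open scoped ContDiff Topology Gradient
open MeasureTheory Set Filter

/-- The derivative of the truncation `trunc δ`: a continuous cutoff vanishing on `[-δ, δ]`. -/
noncomputable def truncDeriv (δ r : ℝ) : ℝ := min 1 (max 0 (|r| / δ - 1))

/-- A `C¹` truncation of the identity, vanishing on `[-δ, δ]`. -/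
noncomputable def trunc (δ τ : ℝ) : ℝ := ∫ r in (0 : ℝ)..τ, truncDeriv δ r

theorem continuous_truncDeriv (δ : ℝ) : Continuous (truncDeriv δ) := by
  unfold truncDeriv; fun_prop

theorem truncDeriv_nonneg (δ r : ℝ) : 0 ≤ truncDeriv δ r :=
  le_min zero_le_one (le_max_left _ _)

theorem truncDeriv_le_one (δ r : ℝ) : truncDeriv δ r ≤ 1 := min_le_left _ _

theorem truncDeriv_eq_zero {δ r : ℝ} (hδ : 0 < δ) (hr : |r| ≤ δ) : truncDeriv δ r = 0 := by
  have : |r| / δ - 1 ≤ 0 := by rw [sub_nonpos, div_le_one hδ]; exact hr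
  simp [truncDeriv, max_eq_left this]

theorem truncDeriv_eq_one {δ r : ℝ} (hδ : 0 < δ) (hr : 2 * δ ≤ |r|) : truncDeriv δ r = 1 := by
  have : 2 ≤ |r| / δ := by rw [le_div_iff₀ hδ]; exact hr
  rw [truncDeriv, min_eq_left]
  exact le_max_of_le_right (by linarith)

theorem hasDerivAt_trunc (δ τ : ℝ) : HasDerivAt (trunc δ) (truncDeriv δ τ) τ :=
  intervalIntegral.integral_hasDerivAt_right ((continuous_truncDeriv δ).intervalIntegrable _ _)
    (continuous_truncDeriv δ).stronglyMeasurable.stronglyMeasurableAtFilter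
    (continuous_truncDeriv δ).continuousAt

theorem deriv_trunc (δ : ℝ) : deriv (trunc δ) = truncDeriv δ :=
  funext fun τ => (hasDerivAt_trunc δ τ).deriv

theorem contDiff_trunc (δ : ℝ) : ContDiff ℝ 1 (trunc δ) :=
  contDiff_one_iff_deriv.2 ⟨fun τ => (hasDerivAt_trunc δ τ).differentiableAt,
    by rw [deriv_trunc]; exact continuous_truncDeriv δ⟩

theorem trunc_eq_zero {δ τ : ℝ} (hδ : 0 < δ) (hτ : |τ| ≤ δ) : trunc δ τ = 0 := by
  refine (intervalIntegral.integral_congr (g := fun _ => (0 : ℝ)) fun r hr => truncDeriv_eq_zero hδ ?_).trans (by simp)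
  have := abs_sub_left_of_mem_uIcc hr
  simp only [sub_zero] at this
  exact this.trans hτ

theorem abs_trunc_le (δ τ : ℝ) : |trunc δ τ| ≤ |τ| := by
  have := intervalIntegral.norm_integral_le_of_norm_le_const (a := 0) (b := τ) (C := 1)
    (f := truncDeriv δ) fun r _ => by
      rw [Real.norm_of_nonneg (truncDeriv_nonneg _ _)]; exact truncDeriv_le_one _ _
  simpa [trunc] using this

/-- The limit is `0`, not `1`, at `r = 0`. This is harmless in the energy integrals because `∇u`
vanishes almost everywhere on the zero set of `u`. -/
theorem tendsto_truncDeriv (r : ℝ) :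
    Tendsto (fun j : ℕ => truncDeriv (1 / ((j : ℝ) + 1)) r) atTop (𝓝 (if r = 0 then 0 else 1)) := by
  split_ifs with h
  · refine tendsto_const_nhds.congr fun j => ?_
    rw [truncDeriv_eq_zero Nat.one_div_pos_of_nat (by rw [h, abs_zero]; positivity)]
  · refine tendsto_const_nhds.congr' ?_
    have h1 : Tendsto (fun j : ℕ => 2 * (1 / ((j : ℝ) + 1))) atTop (𝓝 (2 * 0)) :=
      tendsto_one_div_add_atTop_nhds_zero_nat.const_mul 2
    rw [mul_zero] at h1
    filter_upwards [h1.eventually_le_const (abs_pos.2 h)] with j hj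
    rw [truncDeriv_eq_one Nat.one_div_pos_of_nat hj]

theorem tendsto_trunc (τ : ℝ) :
    Tendsto (fun j : ℕ => trunc (1 / ((j : ℝ) + 1)) τ) atTop (𝓝 τ) := by
  have h := intervalIntegral.tendsto_integral_filter_of_dominated_convergence (a := 0) (b := τ)
    (μ := volume) (l := atTop) (F := fun j : ℕ => truncDeriv (1 / ((j : ℝ) + 1))) (f := fun _ => 1)
    (fun _ => 1)
    (Eventually.of_forall fun j => (continuous_truncDeriv _).aestronglyMeasurable)
    (Eventually.of_forall fun j => Eventually.of_forall fun r _ => by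
      rw [Real.norm_of_nonneg (truncDeriv_nonneg _ _)]; exact truncDeriv_le_one _ _)
    (by simp) (by
      have : ∀ᵐ r : ℝ, r ≠ 0 := by simp [ae_iff]
      filter_upwards [this] with r hr _
      simpa [hr] using tendsto_truncDeriv r)
  simpa [trunc] using h

variable {E : Type*} [NormedAddCommGroup E] [InnerProductSpace ℝ E]

/-- A `C¹` vector field `h` on `Ω` which resembles the orthogonal projection to a subspace of
dimension `m` up to an error `η` and which is radial, in the sense that
`z ↦ z - t h(z)` maps `Ω` to itself and scales `h` by `1 - t`. -/
structure IsRadialField (Ω : Set E) (h : E → E) (C m η t₀ : ℝ) : Prop where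
  isOpen : IsOpen Ω
  isBounded : Bornology.IsBounded Ω
  pos : 0 < t₀
  le_one : t₀ ≤ 1
  contDiffOn : ContDiffOn ℝ 1 h Ω
  norm_le : ∀ z ∈ Ω, ‖h z‖ ≤ C
  norm_fderiv_le : ∀ z ∈ Ω, ‖fderiv ℝ h z‖ ≤ C
  inner_le : ∀ z ∈ Ω, ∀ v, inner ℝ (fderiv ℝ h z v) v ≤ (1 + η) * ‖v‖ ^ 2
  trace_le : ∀ z ∈ Ω, |LinearMap.trace ℝ E (fderiv ℝ h z) - m| ≤ η
  contract_mem : ∀ t : ℝ, 0 ≤ t → t ≤ t₀ → ∀ y ∈ Ω, y - t • h y ∈ Ω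
  contract : ∀ t : ℝ, 0 ≤ t → t ≤ t₀ → ∀ y ∈ Ω, h (y - t • h y) = (1 - t) • h y
  expand : ∀ s : ℝ, 0 ≤ s → s ≤ t₀ → ∀ z ∈ Ω, z + s • h z ∈ Ω → h (z + s • h z) = (1 + s) • h z

/-- The points of `Ω` which `z ↦ z + s h(z)` maps into `Ω`. -/
def expandDomain (Ω : Set E) (h : E → E) (s : ℝ) : Set E := {z | z ∈ Ω ∧ z + s • h z ∈ Ω}

namespace IsRadialField

variable {Ω : Set E} {h : E → E} {C m η t₀ : ℝ}

theorem hasFDerivAt (H : IsRadialField Ω h C m η t₀) {z : E} (hz : z ∈ Ω) (s : ℝ) :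
    HasFDerivAt (fun z => z + s • h z) (1 + s • fderiv ℝ h z) z := by
  have := ((H.contDiffOn.contDiffAt (H.isOpen.mem_nhds hz)).differentiableAt one_ne_zero).hasFDerivAt
  exact (hasFDerivAt_id z).add (this.const_smul s)

theorem continuousOn (H : IsRadialField Ω h C m η t₀) (s : ℝ) :
    ContinuousOn (fun z => z + s • h z) Ω :=
  fun _ hz => (H.hasFDerivAt hz s).continuousAt.continuousWithinAt

theorem isOpen_expandDomain (H : IsRadialField Ω h C m η t₀) (s : ℝ) :
    IsOpen (expandDomain Ω h s) :=
  (H.continuousOn s).isOpen_inter_preimage H.isOpen H.isOpen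

theorem expandDomain_subset (Ω : Set E) (h : E → E) (s : ℝ) : expandDomain Ω h s ⊆ Ω :=
  fun _ hz => hz.1

theorem expandDomain_zero (Ω : Set E) (h : E → E) : expandDomain Ω h 0 = Ω := by
  ext; simp [expandDomain]

/-- The contraction parameter `s / (1 + s)` is determined by `(1 - t)(1 + s) = 1`: with it,
contraction and expansion are mutually inverse. -/
theorem contract_expand (H : IsRadialField Ω h C m η t₀) {s : ℝ} (hs : 0 ≤ s) (hs' : s ≤ t₀)
    {z : E} (hz : z ∈ expandDomain Ω h s) :
    (z + s • h z) - (s / (1 + s)) • h (z + s • h z) = z := by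
  rw [H.expand s hs hs' z hz.1 hz.2, smul_smul, div_mul_cancel₀ _ (by positivity)]
  abel

theorem injOn (H : IsRadialField Ω h C m η t₀) {s : ℝ} (hs : 0 ≤ s) (hs' : s ≤ t₀) :
    InjOn (fun z => z + s • h z) (expandDomain Ω h s) := by
  intro z hz z' hz' heq
  have heq' : z + s • h z = z' + s • h z' := heq
  rw [← H.contract_expand hs hs' hz, ← H.contract_expand hs hs' hz', heq']

theorem div_le (_H : IsRadialField Ω h C m η t₀) {s : ℝ} (hs : 0 ≤ s) (hs' : s ≤ t₀) :
    0 ≤ s / (1 + s) ∧ s / (1 + s) ≤ t₀ :=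
  ⟨by positivity, (div_le_self hs (by linarith)).trans hs'⟩

theorem expand_contract (H : IsRadialField Ω h C m η t₀) {s : ℝ} (hs : 0 ≤ s) (hs' : s ≤ t₀)
    {y : E} (hy : y ∈ Ω) :
    (y - (s / (1 + s)) • h y) + s • h (y - (s / (1 + s)) • h y) = y := by
  obtain ⟨h1, h2⟩ := H.div_le hs hs'
  rw [H.contract _ h1 h2 y hy, smul_smul]
  have : s * (1 - s / (1 + s)) = s / (1 + s) := by field_simp; ring
  rw [this]; abel

theorem image_expandDomain (H : IsRadialField Ω h C m η t₀) {s : ℝ} (hs : 0 ≤ s) (hs' : s ≤ t₀) :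
    (fun z => z + s • h z) '' expandDomain Ω h s = Ω := by
  obtain ⟨h1, h2⟩ := H.div_le hs hs'
  refine Subset.antisymm ?_ fun y hy => ?_
  · rintro _ ⟨z, hz, rfl⟩; exact hz.2
  · refine ⟨y - (s / (1 + s)) • h y, ⟨H.contract_mem _ h1 h2 y hy, ?_⟩, ?_⟩
    · rw [H.expand_contract hs hs' hy]; exact hy
    · exact H.expand_contract hs hs' hy

theorem expandDomain_anti (H : IsRadialField Ω h C m η t₀) {σ s : ℝ} (hσ : 0 ≤ σ) (hσs : σ ≤ s)
    (hs' : s ≤ t₀) : expandDomain Ω h s ⊆ expandDomain Ω h σ := by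
  intro z hz
  have hs : 0 ≤ s := hσ.trans hσs
  refine ⟨hz.1, ?_⟩
  -- The point `z + σ h(z)` is the contraction of `z + s h(z)` with parameter `(s - σ) / (1 + s)`.
  -- Hence the whole segment from `z` to `z + s h(z)` stays in `Ω`.
  have h1 := H.contract_mem ((s - σ) / (1 + s)) (div_nonneg (by linarith) (by linarith))
    ((div_le_self (by linarith) (by linarith)).trans (by linarith)) _ hz.2
  rw [H.expand s hs hs' z hz.1 hz.2, smul_smul, div_mul_cancel₀ _ (by positivity)] at h1
  convert h1 using 1
  rw [sub_smul]; abel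

theorem isCompact_level (H : IsRadialField Ω h C m η t₀) [FiniteDimensional ℝ E] {u : E → ℝ}
    (huc : Continuous u) (hu0 : ∀ x ∉ Ω, u x = 0) {δ : ℝ} (hδ : 0 < δ) :
    IsCompact {x | δ ≤ |u x|} ∧ {x | δ ≤ |u x|} ⊆ Ω := by
  have hsub : {x | δ ≤ |u x|} ⊆ Ω := by
    intro x hx
    by_contra h
    have : δ ≤ |u x| := hx
    rw [hu0 x h, abs_zero] at this; linarith
  exact ⟨Metric.isCompact_of_isClosed_isBounded
    (isClosed_le continuous_const huc.abs) (H.isBounded.subset hsub), hsub⟩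

variable [FiniteDimensional ℝ E] [MeasurableSpace E] [BorelSpace E] (μ : Measure E)
  [μ.IsAddHaarMeasure]

/-- The weak form of `Δu + f(u) = 0` tested with a truncation of `z ↦ u (z + s h(z))`. -/
theorem integral_trunc (H : IsRadialField Ω h C m η t₀) {u : E → ℝ} {f : ℝ → ℝ}
    (huc : Continuous u) (hu0 : ∀ x ∉ Ω, u x = 0)
    (hu : ContDiffOn ℝ 2 u Ω) (hf : Continuous f)
    (heq : ∀ x ∈ Ω, Laplacian.laplacian u x + f (u x) = 0) {s : ℝ} (hs : 0 ≤ s) (hs' : s ≤ t₀)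
    {δ : ℝ} (hδ : 0 < δ) :
    ∫ z in expandDomain Ω h s, truncDeriv δ (u (z + s • h z)) *
        fderiv ℝ u (z + s • h z) ((1 + s • fderiv ℝ h z) (∇ u z)) ∂μ
      = ∫ z in Ω, f (u z) * trunc δ (u (z + s • h z)) ∂μ := by
  obtain ⟨hK, hKΩ⟩ := H.isCompact_level huc hu0 hδ
  set K := {x | δ ≤ |u x|} with hKdef
  obtain ⟨ht1, ht2⟩ := H.div_le hs hs'
  -- The indicator is needed because nothing is known about `h` outside `Ω`.
  let w : E → ℝ := Ω.indicator fun z => trunc δ (u (z + s • h z))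
  -- The support of `w` lies in the contracted copy of the compact level set `K`. Since contraction
  -- preserves `Ω`, that copy is a compact subset of `expandDomain Ω h s`; this is where `s ≥ 0`
  -- matters.
  have hKs : IsCompact ((fun y => y - (s / (1 + s)) • h y) '' K) := by
    refine hK.image_of_continuousOn ?_
    exact continuousOn_id.sub ((H.contDiffOn.continuousOn.mono hKΩ).const_smul _)
  have hKsΩ : (fun y => y - (s / (1 + s)) • h y) '' K ⊆ expandDomain Ω h s := by
    rintro _ ⟨y, hy, rfl⟩
    exact ⟨H.contract_mem _ ht1 ht2 y (hKΩ hy), by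
      show _ + _ ∈ Ω; rw [H.expand_contract hs hs' (hKΩ hy)]; exact hKΩ hy⟩
  have hw0 : ∀ x ∉ (fun y => y - (s / (1 + s)) • h y) '' K, w x = 0 := by
    intro x hx
    by_contra hne
    have hxΩ : x ∈ Ω := by
      by_contra h'; exact hne (indicator_of_notMem h' _)
    have hne' : trunc δ (u (x + s • h x)) ≠ 0 := by
      simpa [w, indicator_of_mem hxΩ] using hne
    have hmem : x + s • h x ∈ K := by
      by_contra h'
      exact hne' (trunc_eq_zero hδ (not_le.1 h').le)
    exact hx ⟨_, hmem, H.contract_expand hs hs' ⟨hxΩ, hKΩ hmem⟩⟩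
  have hwloc : ∀ x ∈ expandDomain Ω h s, w =ᶠ[𝓝 x] fun z => trunc δ (u (z + s • h z)) := by
    intro x hx
    filter_upwards [H.isOpen.mem_nhds hx.1] with z hz using indicator_of_mem hz _
  have hw : ContDiff ℝ 1 w := by
    refine contDiff_of_eq_zero_off_compact (H.isOpen_expandDomain s) hKs hKsΩ ?_ hw0
    intro x hx
    refine ContDiffAt.contDiffWithinAt (ContDiffAt.congr_of_eventuallyEq ?_ (hwloc x hx))
    refine (contDiff_trunc δ).contDiffAt.comp x ?_
    have h1 : ContDiffAt ℝ 1 u (x + s • h x) :=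
      (hu.contDiffAt (H.isOpen.mem_nhds hx.2)).of_le (by norm_num)
    exact h1.comp x (contDiffAt_id.add
      ((H.contDiffOn.contDiffAt (H.isOpen.mem_nhds hx.1)).const_smul s))
  have hmain := integral_fderiv_gradient_eq μ H.isOpen hu hf heq hw hKs
    (hKsΩ.trans (expandDomain_subset Ω h s)) hw0
  have e2 : ∫ x in Ω, f (u x) * w x ∂μ = ∫ z in Ω, f (u z) * trunc δ (u (z + s • h z)) ∂μ :=
    setIntegral_congr_fun H.isOpen.measurableSet fun x hx => by
      simp [w, indicator_of_mem hx]
  rw [← e2, ← hmain]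
  have e1 : ∫ x in Ω, fderiv ℝ w x (∇ u x) ∂μ
      = ∫ x in expandDomain Ω h s, fderiv ℝ w x (∇ u x) ∂μ := by
    refine setIntegral_eq_of_subset_of_forall_sdiff_eq_zero H.isOpen.measurableSet
      (expandDomain_subset Ω h s) fun x hx => ?_
    rw [fderiv_eq_zero_off_compact hKs hw0 fun h' => hx.2 (hKsΩ h')]; rfl
  rw [e1]
  refine setIntegral_congr_fun (H.isOpen_expandDomain s).measurableSet fun x hx => ?_
  have hd1 : HasFDerivAt u (fderiv ℝ u (x + s • h x)) (x + s • h x) :=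
    ((hu.contDiffAt (H.isOpen.mem_nhds hx.2)).differentiableAt two_ne_zero).hasFDerivAt
  have hd2 := (hasDerivAt_trunc δ _).comp_hasFDerivAt x (hd1.comp x (H.hasFDerivAt hx.1 s))
  have hd3 : fderiv ℝ w x = _ := (hwloc x hx).fderiv_eq.trans hd2.fderiv
  simp only [hd3]
  rfl

end IsRadialField

end

/-! ### Change of variables and the energy identity. -/

section

open scoped ContDiff Topology Gradient ENNReal
open MeasureTheory Set Filter

variable {E : Type*} [NormedAddCommGroup E] [InnerProductSpace ℝ E] [FiniteDimensional ℝ E]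

theorem fderiv_apply_eq_inner_gradient (u : E → ℝ) (x v : E) :
    fderiv ℝ u x v = inner ℝ (∇ u x) v := by
  rw [← toDual_gradient, InnerProductSpace.toDual_apply_apply]

theorem norm_gradient_eq (u : E → ℝ) (x : E) : ‖∇ u x‖ = ‖fderiv ℝ u x‖ := by
  rw [← toDual_gradient, LinearIsometryEquiv.norm_map]

/-- `u` is a classical solution of `Δu + f(u) = 0` in `Ω`, extended continuously by zero. -/
structure IsZeroExtendedSolution (f : ℝ → ℝ) (Ω : Set E) (u : E → ℝ) : Prop where
  continuous : Continuous u
  eq_zero : ∀ x ∉ Ω, u x = 0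
  contDiffOn : ContDiffOn ℝ 2 u Ω
  equation : ∀ x ∈ Ω, Laplacian.laplacian u x + f (u x) = 0

variable {Ω : Set E} {h : E → E} {C m η t₀ : ℝ} {u : E → ℝ} {f : ℝ → ℝ}

theorem IsZeroExtendedSolution.continuousOn_gradient (S : IsZeroExtendedSolution f Ω u)
    (hΩ : IsOpen Ω) : ContinuousOn (∇ u) Ω :=
  (InnerProductSpace.toDual ℝ E).symm.continuous.comp_continuousOn
    (S.contDiffOn.fderiv_of_isOpen (m := 1) hΩ (by norm_num)).continuousOn

theorem IsZeroExtendedSolution.hasCompactSupport (S : IsZeroExtendedSolution f Ω u)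
    (hΩ : Bornology.IsBounded Ω) : HasCompactSupport u :=
  HasCompactSupport.intro hΩ.isCompact_closure fun x hx =>
    S.eq_zero x fun h' => hx (subset_closure h')

theorem IsZeroExtendedSolution.exists_abs_le (S : IsZeroExtendedSolution f Ω u)
    (hΩ : Bornology.IsBounded Ω) : ∃ M, 0 ≤ M ∧ ∀ x, |u x| ≤ M := by
  obtain ⟨M, hM⟩ := (S.hasCompactSupport hΩ).exists_bound_of_continuous S.continuous
  exact ⟨M, (norm_nonneg _).trans (hM 0), hM⟩

theorem IsZeroExtendedSolution.exists_abs_comp_le (S : IsZeroExtendedSolution f Ω u)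
    (hΩ : Bornology.IsBounded Ω) (hf : Continuous f) : ∃ B, 0 ≤ B ∧ ∀ x, |f (u x)| ≤ B := by
  obtain ⟨M, hM0, hM⟩ := S.exists_abs_le hΩ
  obtain ⟨B, hB⟩ := (isCompact_Icc (a := -M) (b := M)).exists_bound_of_continuousOn hf.continuousOn
  exact ⟨B, (norm_nonneg _).trans (hB 0 ⟨by linarith, hM0⟩), fun x => hB _ (abs_le.1 (hM x))⟩

variable [MeasurableSpace E] [BorelSpace E] (μ : Measure E) [μ.IsAddHaarMeasure]

theorem integrableOn_of_continuousOn_of_abs_le (hΩ : IsOpen Ω) (hb : Bornology.IsBounded Ω)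
    {g : E → ℝ} (hg : ContinuousOn g Ω) {M : ℝ} (hM : ∀ x ∈ Ω, |g x| ≤ M) :
    IntegrableOn g Ω μ :=
  IntegrableOn.of_bound hb.measure_lt_top (hg.aestronglyMeasurable hΩ.measurableSet) M
    ((ae_restrict_iff' hΩ.measurableSet).2 (Eventually.of_forall hM))

namespace IsRadialField

variable {μ}

/-- Change of variables along `z ↦ z + s h(z)`, with a lower bound for the Jacobian. -/
theorem lintegral_comp_le (H : IsRadialField Ω h C m η t₀) {s : ℝ} (hs : 0 ≤ s) (hs' : s ≤ t₀)
    {a : ℝ} (hdet : ∀ z ∈ Ω, a ≤ (1 + s • fderiv ℝ h z).det) (g : E → ℝ≥0∞) :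
    ENNReal.ofReal a * ∫⁻ z in expandDomain Ω h s, g (z + s • h z) ∂μ ≤ ∫⁻ z in Ω, g z ∂μ := by
  have hm := (H.isOpen_expandDomain s).measurableSet
  have hcv := lintegral_image_eq_lintegral_abs_det_fderiv_mul μ hm
    (fun z hz => (H.hasFDerivAt hz.1 s).hasFDerivWithinAt) (H.injOn hs hs') g
  rw [H.image_expandDomain hs hs'] at hcv
  rw [hcv, ← lintegral_const_mul' _ _ ENNReal.ofReal_ne_top]
  refine setLIntegral_mono' hm fun z hz => ?_
  gcongr
  exact (hdet z hz.1).trans (le_abs_self _)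

theorem lintegral_le_comp (H : IsRadialField Ω h C m η t₀) {s : ℝ} (hs : 0 ≤ s) (hs' : s ≤ t₀)
    {b : ℝ} (hdet : ∀ z ∈ Ω, |(1 + s • fderiv ℝ h z).det| ≤ b) (g : E → ℝ≥0∞) :
    ∫⁻ z in Ω, g z ∂μ ≤ ENNReal.ofReal b * ∫⁻ z in expandDomain Ω h s, g (z + s • h z) ∂μ := by
  have hm := (H.isOpen_expandDomain s).measurableSet
  have hcv := lintegral_image_eq_lintegral_abs_det_fderiv_mul μ hm
    (fun z hz => (H.hasFDerivAt hz.1 s).hasFDerivWithinAt) (H.injOn hs hs') g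
  rw [H.image_expandDomain hs hs'] at hcv
  rw [hcv, ← lintegral_const_mul' _ _ ENNReal.ofReal_ne_top]
  refine setLIntegral_mono' hm fun z hz => ?_
  gcongr
  exact hdet z hz.1

theorem integral_comp_le (H : IsRadialField Ω h C m η t₀) {s : ℝ} (hs : 0 ≤ s) (hs' : s ≤ t₀)
    {a : ℝ} (ha : 0 < a) (hdet : ∀ z ∈ Ω, a ≤ (1 + s • fderiv ℝ h z).det) {g : E → ℝ}
    (hg : ContinuousOn g Ω) (hg0 : ∀ z, 0 ≤ g z) (hgi : IntegrableOn g Ω μ) :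
    IntegrableOn (fun z => g (z + s • h z)) (expandDomain Ω h s) μ ∧
      a * ∫ z in expandDomain Ω h s, g (z + s • h z) ∂μ ≤ ∫ z in Ω, g z ∂μ := by
  have hm := (H.isOpen_expandDomain s).measurableSet
  have hc : ContinuousOn (fun z => g (z + s • h z)) (expandDomain Ω h s) :=
    hg.comp ((H.continuousOn s).mono (expandDomain_subset Ω h s)) fun z hz => hz.2
  have hle := H.lintegral_comp_le (μ := μ) hs hs' hdet fun z => ENNReal.ofReal (g z)
  rw [← ofReal_integral_eq_lintegral_ofReal hgi (Eventually.of_forall hg0)] at hle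
  have hi : IntegrableOn (fun z => g (z + s • h z)) (expandDomain Ω h s) μ := by
    refine ⟨hc.aestronglyMeasurable hm, ?_⟩
    rw [hasFiniteIntegral_iff_ofReal (Eventually.of_forall fun z => hg0 _)]
    -- Integrability is part of the conclusion: as `a > 0`, an infinite integral would contradict
    -- the finite right-hand side of `hle`.
    by_contra hcon
    rw [not_lt, top_le_iff] at hcon
    rw [hcon, ENNReal.mul_top (by simpa using ha)] at hle
    exact ENNReal.ofReal_ne_top (top_le_iff.1 hle)
  refine ⟨hi, ?_⟩
  rw [← ofReal_integral_eq_lintegral_ofReal hi (Eventually.of_forall fun z => hg0 _),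
    ← ENNReal.ofReal_mul ha.le] at hle
  exact (ENNReal.ofReal_le_ofReal_iff (integral_nonneg hg0)).1 hle

theorem integral_le_comp (H : IsRadialField Ω h C m η t₀) {s : ℝ} (hs : 0 ≤ s) (hs' : s ≤ t₀)
    {b : ℝ} (hb : 0 ≤ b) (hdet : ∀ z ∈ Ω, |(1 + s • fderiv ℝ h z).det| ≤ b) {g : E → ℝ}
    (hg0 : ∀ z, 0 ≤ g z) (hgi : IntegrableOn g Ω μ)
    (hi : IntegrableOn (fun z => g (z + s • h z)) (expandDomain Ω h s) μ) :
    ∫ z in Ω, g z ∂μ ≤ b * ∫ z in expandDomain Ω h s, g (z + s • h z) ∂μ := by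
  have hle := H.lintegral_le_comp (μ := μ) hs hs' hdet fun z => ENNReal.ofReal (g z)
  rw [← ofReal_integral_eq_lintegral_ofReal hgi (Eventually.of_forall hg0),
    ← ofReal_integral_eq_lintegral_ofReal hi (Eventually.of_forall fun z => hg0 _),
    ← ENNReal.ofReal_mul hb] at hle
  exact (ENNReal.ofReal_le_ofReal_iff (mul_nonneg hb (integral_nonneg fun z => hg0 _))).1 hle

variable (μ)

/-- `∇u` is square integrable, and `∫ |∇u|² = ∫ f(u) u`. -/
theorem integral_norm_gradient_sq (H : IsRadialField Ω h C m η t₀)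
    (S : IsZeroExtendedSolution f Ω u) (hf : Continuous f) :
    IntegrableOn (fun z => ‖∇ u z‖ ^ 2) Ω μ ∧
      ∫ z in Ω, ‖∇ u z‖ ^ 2 ∂μ = ∫ z in Ω, f (u z) * u z ∂μ := by
  have hΩm := H.isOpen.measurableSet
  obtain ⟨B, hB0, hB⟩ := S.exists_abs_comp_le H.isBounded hf
  obtain ⟨M, hM0, hM⟩ := S.exists_abs_le H.isBounded
  have hgc : ContinuousOn (fun z => ‖∇ u z‖ ^ 2) Ω := (S.continuousOn_gradient H.isOpen).norm.pow 2
  let δ : ℕ → ℝ := fun j => 1 / ((j : ℝ) + 1)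
  have hδ : ∀ j, 0 < δ j := fun j => Nat.one_div_pos_of_nat
  let G : ℕ → E → ℝ := fun j z => truncDeriv (δ j) (u z) * ‖∇ u z‖ ^ 2
  have hG0 : ∀ j z, 0 ≤ G j z := fun j z => mul_nonneg (truncDeriv_nonneg _ _) (sq_nonneg _)
  have hGc : ∀ j, ContinuousOn (G j) Ω := fun j =>
    ((continuous_truncDeriv _).comp S.continuous).continuousOn.mul hgc
  have hGi : ∀ j, IntegrableOn (G j) Ω μ := by
    intro j
    obtain ⟨hK, hKΩ⟩ := H.isCompact_level S.continuous S.eq_zero (hδ j)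
    have : Integrable (G j) μ := by
      rw [← integrableOn_iff_integrable_of_support_subset (s := {x | δ j ≤ |u x|})]
      · exact ((hGc j).mono hKΩ).integrableOn_compact hK
      · intro x hx
        by_contra hcon
        exact hx (by simp [G, truncDeriv_eq_zero (hδ j) (not_le.1 hcon).le])
    exact this.integrableOn
  have hGeq : ∀ j, ∫ z in Ω, G j z ∂μ = ∫ z in Ω, f (u z) * trunc (δ j) (u z) ∂μ := by
    intro j
    -- The case `s = 0` of the weak form.
    have := H.integral_trunc μ S.continuous S.eq_zero S.contDiffOn hf S.equation le_rfl H.pos.le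
      (hδ j)
    simp only [expandDomain_zero, zero_smul, add_zero, one_apply_eq_self,
      fderiv_apply_eq_inner_gradient, real_inner_self_eq_norm_sq] at this
    exact this
  have hRle : ∀ j z, ‖f (u z) * trunc (δ j) (u z)‖ ≤ B * M := by
    intro j z
    rw [norm_mul]
    exact mul_le_mul (hB z) ((abs_trunc_le _ _).trans (hM z)) (norm_nonneg _) hB0
  have hfin : μ Ω < ⊤ := H.isBounded.measure_lt_top
  have hRlim : Tendsto (fun j => ∫ z in Ω, f (u z) * trunc (δ j) (u z) ∂μ) atTop
      (𝓝 (∫ z in Ω, f (u z) * u z ∂μ)) := by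
    refine tendsto_integral_of_dominated_convergence (fun _ => B * M) (fun j => ?_)
      (integrableOn_const hfin.ne) (fun j => Eventually.of_forall (hRle j))
      (Eventually.of_forall fun z => (tendsto_trunc (u z)).const_mul _)
    exact ((hf.comp S.continuous).mul
      ((contDiff_trunc _).continuous.comp S.continuous)).aestronglyMeasurable
  -- Where `u = 0` the truncation factor tends to `0`, but there `∇u = 0` almost everywhere.
  have hGlim : ∀ᵐ z ∂μ.restrict Ω, Tendsto (fun j => G j z) atTop (𝓝 (‖∇ u z‖ ^ 2)) := by
    rw [ae_restrict_iff' hΩm]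
    filter_upwards [ae_fderiv_eq_zero_of_eq_zero μ H.isOpen S.continuous
      (S.contDiffOn.differentiableOn two_ne_zero)] with z hz hzΩ
    have h1 := (tendsto_truncDeriv (u z)).mul_const (‖∇ u z‖ ^ 2)
    by_cases h0 : u z = 0
    · have : ‖∇ u z‖ = 0 := by rw [norm_gradient_eq, hz hzΩ h0, norm_zero]
      simp [G, this]
    · rwa [if_neg h0, one_mul] at h1
  have hint : IntegrableOn (fun z => ‖∇ u z‖ ^ 2) Ω μ := by
    refine ⟨hgc.aestronglyMeasurable hΩm, ?_⟩
    rw [hasFiniteIntegral_iff_ofReal (Eventually.of_forall fun z => sq_nonneg _)]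
    -- Fatou's lemma gives the finiteness of `∫ |∇u|²`, which afterwards serves as the dominating
    -- function for the exact identity.
    have h1 : ∫⁻ z in Ω, ENNReal.ofReal (‖∇ u z‖ ^ 2) ∂μ
        ≤ liminf (fun j => ∫⁻ z in Ω, ENNReal.ofReal (G j z) ∂μ) atTop := by
      refine le_trans (le_of_eq (lintegral_congr_ae ?_)) (lintegral_liminf_le' fun j =>
        (hGi j).aestronglyMeasurable.aemeasurable.ennreal_ofReal)
      filter_upwards [hGlim] with z hz
      exact ((ENNReal.continuous_ofReal.tendsto _).comp hz).liminf_eq.symm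
    refine h1.trans_lt ?_
    have h2 : ∀ j, ∫⁻ z in Ω, ENNReal.ofReal (G j z) ∂μ
        = ENNReal.ofReal (∫ z in Ω, f (u z) * trunc (δ j) (u z) ∂μ) := fun j => by
      rw [← hGeq j, ofReal_integral_eq_lintegral_ofReal (hGi j) (Eventually.of_forall (hG0 j))]
    simp_rw [h2]
    refine lt_of_eq_of_lt ((ENNReal.continuous_ofReal.tendsto _).comp hRlim).liminf_eq ?_
    exact ENNReal.ofReal_lt_top
  refine ⟨hint, tendsto_nhds_unique ?_ hRlim⟩
  simp_rw [← hGeq]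
  refine tendsto_integral_of_dominated_convergence (fun z => ‖∇ u z‖ ^ 2)
    (fun j => (hGi j).aestronglyMeasurable) hint (fun j => Eventually.of_forall fun z => ?_) hGlim
  rw [Real.norm_of_nonneg (hG0 j z)]
  exact mul_le_of_le_one_left (sq_nonneg _) (truncDeriv_le_one _ _)

end IsRadialField

end

/-! ### Estimates for the deformed function. -/

section

open scoped ContDiff Topology Gradient ENNReal
open MeasureTheory Set Filter

variable {E : Type*} [NormedAddCommGroup E] [InnerProductSpace ℝ E] [FiniteDimensional ℝ E]
variable {Ω : Set E} {h : E → E} {C m η t₀ : ℝ} {u : E → ℝ} {f : ℝ → ℝ}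

/-- The gradient of `z ↦ u (z + s h(z))` is this adjoint applied to `∇u`. Its first order term in
`s` is `2 s ⟪A v, v⟫`, so an upper bound on the quadratic form of `A` suffices; `‖A‖` enters only at
order `s²`. -/
theorem norm_adjoint_one_add_smul_sq_le {A : E →L[ℝ] E} {C η s : ℝ} (hC : ‖A‖ ≤ C) (hs : 0 ≤ s)
    (hA : ∀ v, inner ℝ (A v) v ≤ (1 + η) * ‖v‖ ^ 2) (v : E) :
    ‖ContinuousLinearMap.adjoint (1 + s • A) v‖ ^ 2
      ≤ (1 + 2 * s * (1 + η) + s ^ 2 * C ^ 2) * ‖v‖ ^ 2 := by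
  have h1 : ContinuousLinearMap.adjoint (1 + s • A) v
      = v + s • ContinuousLinearMap.adjoint A v := by
    refine ext_inner_right ℝ fun w => ?_
    simp [ContinuousLinearMap.adjoint_inner_left, inner_add_left, inner_smul_left]
  have h2 : inner ℝ v (ContinuousLinearMap.adjoint A v) = inner ℝ (A v) v := by
    rw [ContinuousLinearMap.adjoint_inner_right]
  have h3 : ‖ContinuousLinearMap.adjoint A v‖ ≤ C * ‖v‖ := by
    refine (ContinuousLinearMap.le_opNorm _ _).trans ?_
    rw [LinearIsometryEquiv.norm_map]; gcongr
  rw [h1, norm_add_sq_real, inner_smul_right, h2, norm_smul, Real.norm_of_nonneg hs]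
  have h4 : ‖ContinuousLinearMap.adjoint A v‖ ^ 2 ≤ (C * ‖v‖) ^ 2 := by gcongr
  have h5 := mul_le_mul_of_nonneg_left (hA v) (by positivity : 0 ≤ 2 * s)
  have h6 := mul_le_mul_of_nonneg_left h4 (sq_nonneg s)
  nlinarith

/-- The increment of `u` along `z + σ h(z)`, `0 ≤ σ ≤ s`, in terms of its gradient. -/
theorem IsRadialField.ofReal_abs_comp_sub_le (H : IsRadialField Ω h C m η t₀)
    (S : IsZeroExtendedSolution f Ω u) {s : ℝ} (hs : 0 ≤ s) (hs' : s ≤ t₀) {z : E}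
    (hz : z ∈ expandDomain Ω h s) :
    ENNReal.ofReal |u (z + s • h z) - u z|
      ≤ ∫⁻ σ in Ioc 0 s, ENNReal.ofReal (C * ‖∇ u (z + σ • h z)‖) := by
  have hmem : ∀ σ ∈ Icc 0 s, z + σ • h z ∈ Ω := fun σ hσ =>
    (H.expandDomain_anti hσ.1 hσ.2 hs' hz).2
  have hline : Continuous fun σ : ℝ => z + σ • h z := by fun_prop
  have hd : ∀ σ ∈ uIcc 0 s, HasDerivAt (fun σ : ℝ => u (z + σ • h z))
      (inner ℝ (∇ u (z + σ • h z)) (h z)) σ := by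
    intro σ hσ
    rw [uIcc_of_le hs] at hσ
    have h1 : HasFDerivAt u (fderiv ℝ u (z + σ • h z)) (z + σ • h z) :=
      ((S.contDiffOn.contDiffAt (H.isOpen.mem_nhds (hmem σ hσ))).differentiableAt
        two_ne_zero).hasFDerivAt
    have h2 : HasDerivAt (fun σ : ℝ => z + σ • h z) (h z) σ := by
      simpa using ((hasDerivAt_id σ).smul_const (h z)).const_add z
    rw [← fderiv_apply_eq_inner_gradient]
    exact h1.comp_hasDerivAt σ h2
  have hcont : ContinuousOn (fun σ : ℝ => inner ℝ (∇ u (z + σ • h z)) (h z)) (Icc 0 s) :=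
    ((S.continuousOn_gradient H.isOpen).comp hline.continuousOn hmem).inner continuousOn_const
  have hint : IntervalIntegrable (fun σ : ℝ => inner ℝ (∇ u (z + σ • h z)) (h z)) volume 0 s :=
    (hcont.mono (uIcc_of_le hs).subset).intervalIntegrable
  have hftc := intervalIntegral.integral_eq_sub_of_hasDerivAt hd hint
  rw [zero_smul, add_zero, intervalIntegral.integral_of_le hs] at hftc
  rw [← hftc, ← Real.norm_eq_abs, ofReal_norm]
  refine (enorm_integral_le_lintegral_enorm _).trans (setLIntegral_mono' measurableSet_Ioc
    fun σ _ => ?_)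
  rw [← ofReal_norm]
  refine ENNReal.ofReal_le_ofReal ((norm_inner_le_norm _ _).trans ?_)
  rw [mul_comm]
  gcongr
  exact H.norm_le z hz.1

variable [MeasurableSpace E] [BorelSpace E] (μ : Measure E) [μ.IsAddHaarMeasure]

namespace IsRadialField

/-- In the truncated weak form, Young's inequality bounds the integrand by `½ (|∇u|² + κ |∇u(z + s
h(z))|²)`, and the change of variables bounds the last integral by `D / a`. The bound is uniform in
the truncation, so only the side containing `f` has to be passed to the limit. -/
theorem integral_mul_comp_le (H : IsRadialField Ω h C m η t₀)
    (S : IsZeroExtendedSolution f Ω u) (hf : Continuous f) {s : ℝ} (hs : 0 ≤ s) (hs' : s ≤ t₀)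
    {a κ : ℝ} (ha : 0 < a) (hdet : ∀ z ∈ Ω, a ≤ (1 + s • fderiv ℝ h z).det) (hκ0 : 0 ≤ κ)
    (hκ : ∀ z ∈ Ω, ∀ v, ‖ContinuousLinearMap.adjoint (1 + s • fderiv ℝ h z) v‖ ^ 2
      ≤ κ * ‖v‖ ^ 2) :
    ∫ z in Ω, f (u z) * u (z + s • h z) ∂μ
      ≤ (1 / 2) * (1 + κ / a) * ∫ z in Ω, ‖∇ u z‖ ^ 2 ∂μ := by
  have hΩm := H.isOpen.measurableSet
  have hm := (H.isOpen_expandDomain s).measurableSet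
  obtain ⟨B, hB0, hB⟩ := S.exists_abs_comp_le H.isBounded hf
  obtain ⟨M, hM0, hM⟩ := S.exists_abs_le H.isBounded
  obtain ⟨hgi, -⟩ := H.integral_norm_gradient_sq μ S hf
  have hgc : ContinuousOn (fun z => ‖∇ u z‖ ^ 2) Ω := (S.continuousOn_gradient H.isOpen).norm.pow 2
  obtain ⟨hci, hcle⟩ := H.integral_comp_le hs hs' ha hdet hgc (fun z => sq_nonneg _) hgi
  set D := ∫ z in Ω, ‖∇ u z‖ ^ 2 ∂μ
  have hci' : IntegrableOn (fun z => ‖∇ u z‖ ^ 2) (expandDomain Ω h s) μ :=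
    hgi.mono_set (expandDomain_subset Ω h s)
  let δ : ℕ → ℝ := fun j => 1 / ((j : ℝ) + 1)
  have hδ : ∀ j, 0 < δ j := fun j => Nat.one_div_pos_of_nat
  have hle : ∀ j, ∫ z in Ω, f (u z) * trunc (δ j) (u (z + s • h z)) ∂μ
      ≤ (1 / 2) * (1 + κ / a) * D := by
    intro j
    rw [← H.integral_trunc μ S.continuous S.eq_zero S.contDiffOn hf S.equation hs hs' (hδ j)]
    have hbi : IntegrableOn (fun z => (1 / 2) * ‖∇ u z‖ ^ 2
        + (κ / 2) * ‖∇ u (z + s • h z)‖ ^ 2) (expandDomain Ω h s) μ :=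
      (hci'.const_mul _).add (hci.const_mul _)
    refine (Real.le_norm_self _).trans ((norm_integral_le_of_norm_le hbi ?_).trans ?_)
    · rw [ae_restrict_iff' hm]
      refine Eventually.of_forall fun z hz => ?_
      rw [norm_mul, Real.norm_of_nonneg (truncDeriv_nonneg _ _), fderiv_apply_eq_inner_gradient,
        ← ContinuousLinearMap.adjoint_inner_left]
      refine (mul_le_of_le_one_left (norm_nonneg _) (truncDeriv_le_one _ _)).trans ?_
      refine (norm_inner_le_norm _ _).trans ?_
      have h1 := hκ z hz.1 (∇ u (z + s • h z))
      have h2 := two_mul_le_add_sq ‖ContinuousLinearMap.adjoint (1 + s • fderiv ℝ h z)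
        (∇ u (z + s • h z))‖ ‖∇ u z‖
      linarith
    · rw [integral_add (hci'.const_mul _) (hci.const_mul _), integral_const_mul,
        integral_const_mul]
      have h1 : ∫ z in expandDomain Ω h s, ‖∇ u z‖ ^ 2 ∂μ ≤ D :=
        setIntegral_mono_set hgi (Eventually.of_forall fun z => sq_nonneg _)
          (expandDomain_subset Ω h s).eventuallyLE
      have h2 : ∫ z in expandDomain Ω h s, ‖∇ u (z + s • h z)‖ ^ 2 ∂μ ≤ D / a := by
        rw [le_div_iff₀ ha]; linarith
      have h3 := mul_le_mul_of_nonneg_left h2 hκ0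
      have h4 : κ / a * D = κ * (D / a) := by ring
      linarith
  refine le_of_tendsto' (f := fun j => ∫ z in Ω, f (u z) * trunc (δ j) (u (z + s • h z)) ∂μ)
    (x := atTop) ?_ hle
  have hus : ContinuousOn (fun z => u (z + s • h z)) Ω :=
    S.continuous.comp_continuousOn (H.continuousOn s)
  refine tendsto_integral_of_dominated_convergence (fun _ => B * M) (fun j => ?_)
    (integrableOn_const H.isBounded.measure_lt_top.ne)
    (fun j => Eventually.of_forall fun z => ?_)
    (Eventually.of_forall fun z => (tendsto_trunc _).const_mul _)
  · exact ((hf.comp S.continuous).continuousOn.mul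
      ((contDiff_trunc _).continuous.comp_continuousOn hus)).aestronglyMeasurable hΩm
  · rw [norm_mul]
    exact mul_le_mul (hB z) ((abs_trunc_le _ _).trans (hM _)) (norm_nonneg _) hB0

/-- This is the `O(s)` bound in `L¹` that makes the Taylor remainder of `F` negligible. On
`expandDomain`, `u` is integrated along the segments `z + σ h(z)`; Fubini and the Jacobian bound
`1/2` give the factor `2`. Elsewhere in `Ω` the deformed function is zero, and that set is small. -/
theorem integral_abs_comp_sub_le (H : IsRadialField Ω h C m η t₀)
    (S : IsZeroExtendedSolution f Ω u) (hC : 0 ≤ C) {s : ℝ} (hs : 0 ≤ s) (hs' : s ≤ t₀)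
    {L M : ℝ} (hL : 0 ≤ L) (hM0 : 0 ≤ M) (hM : ∀ x, |u x| ≤ M)
    (hgi : IntegrableOn (fun z => ‖∇ u z‖) Ω μ)
    (hlow : ∀ σ, 0 ≤ σ → σ ≤ s → ∀ z ∈ Ω, 1 / 2 ≤ (1 + σ • fderiv ℝ h z).det)
    (hup : ∀ z ∈ Ω, |(1 + s • fderiv ℝ h z).det| ≤ 1 + L * s) :
    ∫ z in Ω, |u (z + s • h z) - u z| ∂μ
      ≤ (M * L * μ.real Ω + 2 * C * ∫ z in Ω, ‖∇ u z‖ ∂μ) * s := by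
  have hΩm := H.isOpen.measurableSet
  have hm := (H.isOpen_expandDomain s).measurableSet
  have hfin : μ Ω < ⊤ := H.isBounded.measure_lt_top
  have hsub := expandDomain_subset Ω h s
  have hfin' : μ (expandDomain Ω h s) < ⊤ := (measure_mono hsub).trans_lt hfin
  have hus : ContinuousOn (fun z => |u (z + s • h z) - u z|) Ω :=
    ((S.continuous.comp_continuousOn (H.continuousOn s)).sub S.continuous.continuousOn).abs
  have hi : IntegrableOn (fun z => |u (z + s • h z) - u z|) Ω μ :=
    integrableOn_of_continuousOn_of_abs_le μ H.isOpen H.isBounded hus (M := M + M) fun x _ => by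
      rw [abs_abs]; exact (abs_sub _ _).trans (add_le_add (hM _) (hM _))
  have hsplit := setIntegral_sdiff hm hi hsub
  have hsecond : ∫ z in Ω \ expandDomain Ω h s, |u (z + s • h z) - u z| ∂μ
      ≤ M * (L * s * μ.real Ω) := by
    have h1 : ∫ z in Ω \ expandDomain Ω h s, |u (z + s • h z) - u z| ∂μ
        ≤ ∫ z in Ω \ expandDomain Ω h s, M ∂μ := by
      refine setIntegral_mono_on (hi.mono_set sdiff_subset)
        (integrableOn_const ((measure_mono sdiff_subset).trans_lt hfin).ne) (hΩm.diff hm)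
        fun z hz => ?_
      have : z + s • h z ∉ Ω := fun h' => hz.2 ⟨hz.1, h'⟩
      rw [S.eq_zero _ this, zero_sub, abs_neg]
      exact hM z
    -- The expansion maps `expandDomain` onto `Ω` and multiplies volume by at most `1 + L s`, so at
    -- most `L s μ(Ω)` of `Ω` is left uncovered by `expandDomain`.
    have h2 : μ.real Ω ≤ (1 + L * s) * μ.real (expandDomain Ω h s) := by
      have := H.integral_le_comp (μ := μ) hs hs' (by positivity) hup (g := fun _ => 1)
        (fun _ => zero_le_one) (integrableOn_const hfin.ne) (integrableOn_const hfin'.ne)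
      simpa using this
    have h3 : μ.real (Ω \ expandDomain Ω h s) = μ.real Ω - μ.real (expandDomain Ω h s) :=
      measureReal_sdiff hsub hm hfin.ne
    have h4 : μ.real (expandDomain Ω h s) ≤ μ.real Ω := measureReal_mono hsub hfin.ne
    have h5 : L * s * μ.real (expandDomain Ω h s) ≤ L * s * μ.real Ω := by gcongr
    rw [setIntegral_const, h3, smul_eq_mul, mul_comm] at h1
    refine h1.trans ?_
    gcongr
    linarith
  have hfirst : ∫ z in expandDomain Ω h s, |u (z + s • h z) - u z| ∂μ
      ≤ s * (2 * (C * ∫ z in Ω, ‖∇ u z‖ ∂μ)) := by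
    rw [← ENNReal.ofReal_le_ofReal_iff (by positivity),
      ofReal_integral_eq_lintegral_ofReal (hi.mono_set hsub)
        (Eventually.of_forall fun z => abs_nonneg _)]
    have hmeas : AEMeasurable (Function.uncurry fun (z : E) (σ : ℝ) =>
        ENNReal.ofReal (C * ‖∇ u (z + σ • h z)‖))
        ((μ.restrict (expandDomain Ω h s)).prod (volume.restrict (Ioc 0 s))) := by
      rw [Measure.prod_restrict]
      refine AEMeasurable.ennreal_ofReal (ContinuousOn.aemeasurable ?_ (hm.prod measurableSet_Ioc))
      refine continuousOn_const.mul (ContinuousOn.norm ?_)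
      refine (S.continuousOn_gradient H.isOpen).comp ?_ fun p hp =>
        (H.expandDomain_anti hp.2.1.le hp.2.2 hs' hp.1).2
      exact continuousOn_fst.add (continuousOn_snd.smul
        (H.contDiffOn.continuousOn.comp continuousOn_fst fun p hp => hsub hp.1))
    calc ∫⁻ z in expandDomain Ω h s, ENNReal.ofReal |u (z + s • h z) - u z| ∂μ
        ≤ ∫⁻ z in expandDomain Ω h s, (∫⁻ σ in Ioc 0 s,
            ENNReal.ofReal (C * ‖∇ u (z + σ • h z)‖)) ∂μ :=
          setLIntegral_mono' hm fun z hz => H.ofReal_abs_comp_sub_le S hs hs' hz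
      _ = ∫⁻ σ in Ioc 0 s, (∫⁻ z in expandDomain Ω h s,
            ENNReal.ofReal (C * ‖∇ u (z + σ • h z)‖) ∂μ) := lintegral_lintegral_swap hmeas
      _ ≤ ∫⁻ _ in Ioc 0 s, ENNReal.ofReal (2 * (C * ∫ z in Ω, ‖∇ u z‖ ∂μ)) := by
          refine setLIntegral_mono' measurableSet_Ioc fun σ hσ => ?_
          have h1 := H.lintegral_comp_le (μ := μ) hσ.1.le (hσ.2.trans hs')
            (hlow σ hσ.1.le hσ.2) fun z => ENNReal.ofReal (C * ‖∇ u z‖)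
          rw [← ofReal_integral_eq_lintegral_ofReal (hgi.const_mul C)
            (Eventually.of_forall fun z => by positivity), integral_const_mul] at h1
          have h2 : ∫⁻ z in expandDomain Ω h s, ENNReal.ofReal (C * ‖∇ u (z + σ • h z)‖) ∂μ
              ≤ ∫⁻ z in expandDomain Ω h σ, ENNReal.ofReal (C * ‖∇ u (z + σ • h z)‖) ∂μ :=
            lintegral_mono_set (H.expandDomain_anti hσ.1.le hσ.2 hs')
          refine h2.trans ?_
          have h3 := mul_le_mul_right h1 (ENNReal.ofReal 2)
          rw [← mul_assoc, ← ENNReal.ofReal_mul zero_le_two, ← ENNReal.ofReal_mul zero_le_two] at h3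
          simpa using h3
      _ = ENNReal.ofReal (s * (2 * (C * ∫ z in Ω, ‖∇ u z‖ ∂μ))) := by
          rw [setLIntegral_const, Real.volume_Ioc, sub_zero, mul_comm, ENNReal.ofReal_mul hs]
  linarith

end IsRadialField

end

/-! ### Energy comparison and vanishing of solutions. -/

section

open scoped ContDiff Topology Gradient ENNReal
open MeasureTheory Set Filter

variable {E : Type*} [NormedAddCommGroup E] [InnerProductSpace ℝ E] [FiniteDimensional ℝ E]
variable {Ω : Set E} {h : E → E} {C m η t₀ : ℝ} {u : E → ℝ} {f : ℝ → ℝ}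

theorem hasDerivAt_primitive (hf : Continuous f) (t : ℝ) :
    HasDerivAt (fun t => ∫ τ in (0 : ℝ)..t, f τ) (f t) t :=
  intervalIntegral.integral_hasDerivAt_right (hf.intervalIntegrable _ _)
    hf.stronglyMeasurable.stronglyMeasurableAtFilter hf.continuousAt

theorem continuous_primitive (hf : Continuous f) :
    Continuous fun t => ∫ τ in (0 : ℝ)..t, f τ :=
  continuous_iff_continuousAt.2 fun t => (hasDerivAt_primitive hf t).continuousAt

/-- As `f` is only continuous, the remainder is `o(|b - a|)`, not quadratic; uniform continuity of
`f` on `[-M, M]` makes it uniform. -/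
theorem exists_primitive_sub_le (hf : Continuous f) {M θ : ℝ} (hθ : 0 < θ) :
    ∃ δ > 0, ∀ a b : ℝ, |a| ≤ M → |b| ≤ M → |b - a| < δ →
      (∫ τ in (0 : ℝ)..b, f τ) - (∫ τ in (0 : ℝ)..a, f τ) - f a * (b - a) ≤ θ * |b - a| := by
  have huc := (isCompact_Icc (a := -M) (b := M)).uniformContinuousOn_of_continuous
    hf.continuousOn
  obtain ⟨δ, hδ, h⟩ := Metric.uniformContinuousOn_iff.1 huc θ hθ
  refine ⟨δ, hδ, fun a b ha hb hab => ?_⟩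
  have hsub : ∫ τ in a..b, (f τ - f a)
      = (∫ τ in (0 : ℝ)..b, f τ) - (∫ τ in (0 : ℝ)..a, f τ) - f a * (b - a) := by
    rw [intervalIntegral.integral_sub (hf.intervalIntegrable _ _) (by simp),
      intervalIntegral.integral_const,
      intervalIntegral.integral_interval_sub_left (hf.intervalIntegrable _ _)
        (hf.intervalIntegrable _ _), smul_eq_mul]
    ring
  rw [← hsub]
  refine (Real.le_norm_self _).trans (intervalIntegral.norm_integral_le_of_norm_le_const
    fun τ hτ => ?_)
  have hτ' := uIoc_subset_uIcc hτ
  have hmem : τ ∈ Icc (-M) M :=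
    uIcc_subset_Icc (abs_le.1 ha) (abs_le.1 hb) hτ'
  rw [← dist_eq_norm]
  exact (h τ hmem a (abs_le.1 ha) (by
    rw [Real.dist_eq]; exact (abs_sub_left_of_mem_uIcc hτ').trans_lt hab)).le

/-- Uniform first order expansion of the primitive of `f` along `z ↦ z + s h(z)`. -/
theorem IsRadialField.exists_primitive_comp_sub_le (H : IsRadialField Ω h C m η t₀)
    (S : IsZeroExtendedSolution f Ω u) (hf : Continuous f) (hC : 0 < C) {θ : ℝ} (hθ : 0 < θ) :
    ∃ s₁ > 0, ∀ s : ℝ, 0 ≤ s → s ≤ s₁ → ∀ z ∈ Ω,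
      (∫ τ in (0 : ℝ)..u (z + s • h z), f τ) - (∫ τ in (0 : ℝ)..u z, f τ)
        - f (u z) * (u (z + s • h z) - u z) ≤ θ * |u (z + s • h z) - u z| := by
  obtain ⟨M, hM0, hM⟩ := S.exists_abs_le H.isBounded
  obtain ⟨δ, hδ, hF⟩ := exists_primitive_sub_le (M := M) hf hθ
  have huc := (S.hasCompactSupport H.isBounded).uniformContinuous_of_continuous S.continuous
  obtain ⟨r, hr, hu⟩ := Metric.uniformContinuous_iff.1 huc δ hδ
  refine ⟨r / (2 * C), by positivity, fun s hs0 hs z hz => hF _ _ (hM _) (hM _) ?_⟩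
  rw [← Real.dist_eq]
  refine hu ?_
  rw [dist_eq_norm, add_sub_cancel_left, norm_smul, Real.norm_of_nonneg hs0]
  have h1 : s * ‖h z‖ ≤ r / (2 * C) * C :=
    mul_le_mul hs (H.norm_le z hz) (norm_nonneg _) (by positivity)
  have h2 : r / (2 * C) * C = r / 2 := by field_simp
  linarith

/-- One `η` pays for the expansion of the determinant, the other for the distance of the trace from
`m`. -/
theorem IsRadialField.exists_det_bounds (H : IsRadialField Ω h C m η t₀) (hC : 0 < C)
    (hη : 0 < η) : ∃ s₁ > 0, ∀ s : ℝ, 0 ≤ s → s ≤ s₁ → ∀ z ∈ Ω,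
      1 + s * (m - 2 * η) ≤ (1 + s • fderiv ℝ h z).det ∧
        (1 + s • fderiv ℝ h z).det ≤ 1 + s * (m + 2 * η) := by
  obtain ⟨s₁, hs₁, hdet⟩ := exists_abs_det_one_add_smul_sub_le (E := E) hC hη
  refine ⟨s₁, hs₁, fun s hs0 hs z hz => ?_⟩
  have h1 := abs_le.1 (hdet s hs0 hs _ (H.norm_fderiv_le z hz))
  have h2 := abs_le.1 (H.trace_le z hz)
  have h3 := mul_le_mul_of_nonneg_left h2.1 hs0
  have h4 := mul_le_mul_of_nonneg_left h2.2 hs0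
  constructor <;> nlinarith [h1.1, h1.2]

variable [MeasurableSpace E] [BorelSpace E] (μ : Measure E) [μ.IsAddHaarMeasure]

namespace IsRadialField

theorem integrableOn_norm_gradient (H : IsRadialField Ω h C m η t₀)
    (S : IsZeroExtendedSolution f Ω u) (hf : Continuous f) :
    IntegrableOn (fun z => ‖∇ u z‖) Ω μ := by
  have hg := (H.integral_norm_gradient_sq μ S hf).1
  have hc : IntegrableOn (fun _ : E => (1 : ℝ)) Ω μ :=
    integrableOn_const H.isBounded.measure_lt_top.ne
  refine Integrable.mono' (hc.add hg)
    ((S.continuousOn_gradient H.isOpen).norm.aestronglyMeasurable H.isOpen.measurableSet)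
    (Eventually.of_forall fun z => ?_)
  simp only [norm_norm, Pi.add_apply]
  nlinarith [sq_nonneg (‖∇ u z‖ - 1)]

/-- The energy comparison between `u` and `z ↦ u (z + s h(z))`, for a fixed small `s`. -/
theorem energy_comparison (H : IsRadialField Ω h C m η t₀)
    (S : IsZeroExtendedSolution f Ω u) (hf : Continuous f) {s : ℝ} (hs : 0 ≤ s) (hs' : s ≤ t₀)
    (hF0 : ∀ t, 0 ≤ ∫ τ in (0 : ℝ)..t, f τ)
    {a b κ θ : ℝ} (ha : 0 < a) (hb : 0 < b)
    (hlow : ∀ z ∈ Ω, a ≤ (1 + s • fderiv ℝ h z).det)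
    (hup : ∀ z ∈ Ω, |(1 + s • fderiv ℝ h z).det| ≤ b) (hκ0 : 0 ≤ κ)
    (hκ : ∀ z ∈ Ω, ∀ v, ‖ContinuousLinearMap.adjoint (1 + s • fderiv ℝ h z) v‖ ^ 2
      ≤ κ * ‖v‖ ^ 2)
    (hθ : ∀ z ∈ Ω, (∫ τ in (0 : ℝ)..u (z + s • h z), f τ) - (∫ τ in (0 : ℝ)..u z, f τ)
        - f (u z) * (u (z + s • h z) - u z) ≤ θ * |u (z + s • h z) - u z|) :
    (1 / b - 1) * ∫ z in Ω, (∫ τ in (0 : ℝ)..u z, f τ) ∂μ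
        - θ * ∫ z in Ω, |u (z + s • h z) - u z| ∂μ
      ≤ (1 / 2) * (κ / a - 1) * ∫ z in Ω, ‖∇ u z‖ ^ 2 ∂μ := by
  set F : ℝ → ℝ := fun t => ∫ τ in (0 : ℝ)..t, f τ with hFdef
  have hFc : Continuous F := continuous_primitive hf
  have hΩm := H.isOpen.measurableSet
  have hm := (H.isOpen_expandDomain s).measurableSet
  obtain ⟨B, hB0, hB⟩ := S.exists_abs_comp_le H.isBounded hf
  obtain ⟨M, hM0, hM⟩ := S.exists_abs_le H.isBounded
  obtain ⟨BF, hBF⟩ := (isCompact_Icc (a := -M) (b := M)).exists_bound_of_continuousOn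
    hFc.continuousOn
  have hBF' : ∀ x, |F (u x)| ≤ BF := fun x => hBF _ (abs_le.1 (hM x))
  have hus : ContinuousOn (fun z => u (z + s • h z)) Ω :=
    S.continuous.comp_continuousOn (H.continuousOn s)
  have int : ∀ {g : E → ℝ} {K : ℝ}, ContinuousOn g Ω → (∀ x, |g x| ≤ K) → IntegrableOn g Ω μ :=
    fun hg hK => integrableOn_of_continuousOn_of_abs_le μ H.isOpen H.isBounded hg fun x _ => hK x
  have i1 : IntegrableOn (fun z => f (u z) * u (z + s • h z)) Ω μ :=
    int (K := B * M) ((hf.comp S.continuous).continuousOn.mul hus) fun x => by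
      rw [abs_mul]; exact mul_le_mul (hB x) (hM _) (abs_nonneg _) hB0
  have i2 : IntegrableOn (fun z => f (u z) * u z) Ω μ :=
    int (K := B * M) ((hf.comp S.continuous).mul S.continuous).continuousOn fun x => by
      rw [abs_mul]; exact mul_le_mul (hB x) (hM _) (abs_nonneg _) hB0
  have i3 : IntegrableOn (fun z => F (u z)) Ω μ :=
    int (hFc.comp S.continuous).continuousOn hBF'
  have i4 : IntegrableOn (fun z => F (u (z + s • h z))) Ω μ :=
    int (hFc.comp_continuousOn hus) fun x => hBF' _
  have i5 : IntegrableOn (fun z => |u (z + s • h z) - u z|) Ω μ :=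
    int (K := M + M) (hus.sub S.continuous.continuousOn).abs fun x => by
      rw [abs_abs]; exact (abs_sub _ _).trans (add_le_add (hM _) (hM _))
  have h1 := H.integral_mul_comp_le μ S hf hs hs' ha hlow hκ0 hκ
  have h2 := (H.integral_norm_gradient_sq μ S hf).2
  have h3 : ∫ z in Ω, F (u (z + s • h z)) ∂μ - ∫ z in Ω, F (u z) ∂μ
      - (∫ z in Ω, f (u z) * u (z + s • h z) ∂μ - ∫ z in Ω, f (u z) * u z ∂μ)
      ≤ θ * ∫ z in Ω, |u (z + s • h z) - u z| ∂μ := by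
    have i6 : IntegrableOn (fun z => F (u (z + s • h z)) - F (u z)) Ω μ := i4.sub i3
    have i7 : IntegrableOn (fun z => f (u z) * u (z + s • h z) - f (u z) * u z) Ω μ := i1.sub i2
    rw [← integral_sub i4 i3, ← integral_sub i1 i2, ← integral_const_mul, ← integral_sub i6 i7]
    refine setIntegral_mono_on (i6.sub i7) (i5.const_mul θ) hΩm fun z hz => ?_
    have := hθ z hz
    rw [mul_sub] at this
    exact this
  have h4 : (1 / b) * ∫ z in Ω, F (u z) ∂μ ≤ ∫ z in Ω, F (u (z + s • h z)) ∂μ := by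
    have h5 := H.integral_le_comp (μ := μ) hs hs' hb.le hup (g := fun z => F (u z))
      (fun z => hF0 _) i3 (i4.mono_set (expandDomain_subset Ω h s))
    -- Nonnegativity of the primitive allows the part outside `expandDomain` to be discarded.
    have h6 : ∫ z in expandDomain Ω h s, F (u (z + s • h z)) ∂μ
        ≤ ∫ z in Ω, F (u (z + s • h z)) ∂μ :=
      setIntegral_mono_set i4 (Eventually.of_forall fun z => hF0 _)
        (expandDomain_subset Ω h s).eventuallyLE
    rw [one_div, inv_mul_le_iff₀ hb]
    exact h5.trans (by gcongr)
  rw [← h2] at h3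
  linarith

-- The function is locally constant in `Ω`. A level set of a nonzero value lies in `Ω`, hence is
-- clopen in the whole space, which is impossible as `Ω` is bounded. Connectedness of `Ω` plays no
-- role.
omit [BorelSpace E] in
theorem eq_zero_of_integral_norm_gradient_sq_eq_zero (H : IsRadialField Ω h C m η t₀)
    (S : IsZeroExtendedSolution f Ω u) [Nontrivial E]
    (hgi : IntegrableOn (fun z => ‖∇ u z‖ ^ 2) Ω μ)
    (hD : ∫ z in Ω, ‖∇ u z‖ ^ 2 ∂μ = 0) (x : E) : u x = 0 := by
  have hgc : ContinuousOn (fun z => ‖∇ u z‖ ^ 2) Ω := (S.continuousOn_gradient H.isOpen).norm.pow 2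
  have hae := (setIntegral_eq_zero_iff_of_nonneg_ae (Eventually.of_forall fun z => sq_nonneg _)
    hgi).1 hD
  have hgrad : ∀ z ∈ Ω, fderiv ℝ u z = 0 := by
    have h0 := Measure.eqOn_open_of_ae_eq hae H.isOpen hgc continuousOn_const
    intro z hz
    have h1 : ‖∇ u z‖ ^ 2 = 0 := h0 hz
    rw [norm_gradient_eq] at h1
    simpa using h1
  by_contra hx
  have hmem : ∀ y, u y = u x → y ∈ Ω := by
    intro y hy
    by_contra hcon
    exact hx (hy ▸ S.eq_zero y hcon)
  have hclopen : IsClopen {y | u y = u x} := by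
    refine ⟨isClosed_eq S.continuous continuous_const, ?_⟩
    rw [Metric.isOpen_iff]
    intro y hy
    obtain ⟨r, hr, hball⟩ := Metric.isOpen_iff.1 H.isOpen y (hmem y hy)
    refine ⟨r, hr, fun w hw => ?_⟩
    have := (convex_ball y r).is_const_of_fderivWithin_eq_zero (𝕜 := ℝ) (f := u)
      ((S.contDiffOn.differentiableOn two_ne_zero).mono hball)
      (fun v hv => by rw [fderivWithin_of_isOpen Metric.isOpen_ball hv, hgrad v (hball hv)])
      hw (Metric.mem_ball_self hr)
    exact this.trans hy
  have huniv := hclopen.eq_univ ⟨x, rfl⟩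
  have hΩuniv : Ω = univ := eq_univ_of_forall fun y => hmem y (huniv ▸ mem_univ y : y ∈ {y | u y = u x})
  exact NormedSpace.unbounded_univ ℝ E (hΩuniv ▸ H.isBounded)

/-- Nonexistence of nontrivial solutions in domains which carry a radial field. -/
theorem solution_eq_zero (H : IsRadialField Ω h C m η t₀)
    (S : IsZeroExtendedSolution f Ω u) [Nontrivial E] (hf : Continuous f)
    (hC : 0 < C) (hη : 0 < η) (hmη : 2 * η ≤ m) {p : ℝ} (hp : 0 < p)
    (hfp : ∀ t : ℝ, p * (∫ τ in (0 : ℝ)..t, f τ) ≤ t * f t ∧ 0 ≤ p * ∫ τ in (0 : ℝ)..t, f τ)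
    (hneg : 1 + 2 * η - m / 2 + (m + 2 * η) / p < 0) (x : E) : u x = 0 := by
  borelize E
  let μ : Measure E := Measure.addHaar
  obtain ⟨M, hM0, hM⟩ := S.exists_abs_le H.isBounded
  have hF0 : ∀ t, 0 ≤ ∫ τ in (0 : ℝ)..t, f τ := fun t => nonneg_of_mul_nonneg_right (hfp t).2 hp
  obtain ⟨hgi, hDeq⟩ := H.integral_norm_gradient_sq μ S hf
  have hgi1 := H.integrableOn_norm_gradient μ S hf
  obtain ⟨s₁, hs₁, hdet⟩ := H.exists_det_bounds hC hη
  set D := ∫ z in Ω, ‖∇ u z‖ ^ 2 ∂μ with hD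
  set Φ := ∫ z in Ω, (∫ τ in (0 : ℝ)..u z, f τ) ∂μ with hΦ
  set B := M * (m + 2 * η) * μ.real Ω + 2 * C * ∫ z in Ω, ‖∇ u z‖ ∂μ with hBdef
  have hD0 : 0 ≤ D := integral_nonneg fun z => sq_nonneg _
  have hΦ0 : 0 ≤ Φ := integral_nonneg fun z => hF0 _
  have hB0 : 0 ≤ B := by
    have : 0 ≤ m + 2 * η := by linarith
    positivity
  -- Integrate `p F(u) ≤ u f(u)` and use `D = ∫ f(u) u`.
  have hΦD : p * Φ ≤ D := by
    rw [hDeq, hΦ, ← integral_const_mul]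
    obtain ⟨K, hK0, hK⟩ := S.exists_abs_comp_le H.isBounded hf
    have i2 : IntegrableOn (fun z => f (u z) * u z) Ω μ :=
      integrableOn_of_continuousOn_of_abs_le μ H.isOpen H.isBounded (M := K * M)
        ((hf.comp S.continuous).mul S.continuous).continuousOn fun x _ => by
          rw [abs_mul]; exact mul_le_mul (hK x) (hM _) (abs_nonneg _) hK0
    refine integral_mono_of_nonneg (Eventually.of_forall fun z => (hfp (u z)).2) i2
      (Eventually.of_forall fun z => ?_)
    have := (hfp (u z)).1
    rw [mul_comm (u z)] at this
    exact this
  -- The comparison is divided by `s` and `s → 0⁺` with `θ` fixed. The range of `s` depends on `θ`,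
  -- but `B` does not, so `θ → 0` can follow.
  have hlim : ∀ θ > 0, -(m + 2 * η) * Φ - θ * B ≤ (1 / 2) * (2 + 4 * η - m) * D := by
    intro θ hθ
    obtain ⟨s₂, hs₂, hprim⟩ := H.exists_primitive_comp_sub_le S hf hC hθ
    have hev : ∀ᶠ s in 𝓝[>] (0 : ℝ), -(m + 2 * η) * Φ - θ * B
        ≤ (1 / 2) * ((2 + 4 * η - m + s * C ^ 2) / (1 + s * (m - 2 * η))) * D := by
      have hmem : Ioo (0 : ℝ) (min t₀ (min s₁ s₂)) ∈ 𝓝[>] (0 : ℝ) :=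
        Ioo_mem_nhdsGT (lt_min H.pos (lt_min hs₁ hs₂))
      filter_upwards [hmem] with s hs
      have hs0 : 0 ≤ s := hs.1.le
      have hst : s ≤ t₀ := hs.2.le.trans (min_le_left _ _)
      have hs1 : s ≤ s₁ := hs.2.le.trans ((min_le_right _ _).trans (min_le_left _ _))
      have hs2 : s ≤ s₂ := hs.2.le.trans ((min_le_right _ _).trans (min_le_right _ _))
      have ha1 : ∀ σ, 0 ≤ σ → 1 ≤ 1 + σ * (m - 2 * η) := fun σ hσ => by
        nlinarith
      have ha : 0 < 1 + s * (m - 2 * η) := by linarith [ha1 s hs0]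
      have hsm : 0 ≤ s * (m + 2 * η) := mul_nonneg hs0 (by linarith)
      have hb : 0 < 1 + s * (m + 2 * η) := by linarith
      have hup : ∀ z ∈ Ω, |(1 + s • fderiv ℝ h z).det| ≤ 1 + s * (m + 2 * η) := fun z hz => by
        have h1 := hdet s hs0 hs1 z hz
        rw [abs_of_pos (ha.trans_le h1.1)]; exact h1.2
      have hκ0 : 0 ≤ 1 + 2 * s * (1 + η) + s ^ 2 * C ^ 2 := by positivity
      have h1 := H.energy_comparison μ S hf hs0 hst hF0 ha hb
        (fun z hz => (hdet s hs0 hs1 z hz).1) hup hκ0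
        (fun z hz v => norm_adjoint_one_add_smul_sq_le (H.norm_fderiv_le z hz) hs0
          (H.inner_le z hz) v) (hprim s hs0 hs2)
      have h2 := H.integral_abs_comp_sub_le μ S hC.le hs0 hst (L := m + 2 * η) (by linarith) hM0 hM
        hgi1 (fun σ hσ hσs z hz => by
          linarith [(hdet σ hσ (hσs.trans hs1) z hz).1, ha1 σ hσ])
        (fun z hz => by rw [mul_comm]; exact hup z hz)
      have h3 : -(s * (m + 2 * η)) ≤ 1 / (1 + s * (m + 2 * η)) - 1 := by
        rw [le_sub_iff_add_le, le_div_iff₀ hb]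
        nlinarith
      have h4 := mul_le_mul_of_nonneg_right h3 hΦ0
      have h5 := mul_le_mul_of_nonneg_left h2 hθ.le
      have h6 : (1 + 2 * s * (1 + η) + s ^ 2 * C ^ 2) / (1 + s * (m - 2 * η)) - 1
          = s * ((2 + 4 * η - m + s * C ^ 2) / (1 + s * (m - 2 * η))) := by
        field_simp; ring
      rw [h6] at h1
      have h7 : s * (-(m + 2 * η) * Φ - θ * B)
          ≤ s * ((1 / 2) * ((2 + 4 * η - m + s * C ^ 2) / (1 + s * (m - 2 * η))) * D) := by
        linarith
      exact le_of_mul_le_mul_left h7 hs.1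
    have hcont : ContinuousAt (fun s : ℝ =>
        (1 / 2) * ((2 + 4 * η - m + s * C ^ 2) / (1 + s * (m - 2 * η))) * D) 0 := by
      have : ContinuousAt (fun s : ℝ =>
          (2 + 4 * η - m + s * C ^ 2) / (1 + s * (m - 2 * η))) 0 :=
        ContinuousAt.div (by fun_prop) (by fun_prop) (by simp)
      fun_prop
    have htend := hcont.tendsto.mono_left (nhdsWithin_le_nhds (s := Ioi 0))
    have := ge_of_tendsto htend hev
    simpa using this
  have hfinal : -(m + 2 * η) * Φ ≤ (1 / 2) * (2 + 4 * η - m) * D := by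
    refine le_of_forall_pos_le_add fun ε hε => ?_
    have h1 := hlim (ε / (B + 1)) (by positivity)
    have h2 : ε / (B + 1) * B ≤ ε := by
      rw [div_mul_eq_mul_div, div_le_iff₀ (by positivity)]
      nlinarith
    linarith
  have hΦ' : Φ ≤ D / p := by rw [le_div_iff₀ hp]; linarith
  have h5 : (m + 2 * η) * Φ ≤ (m + 2 * η) * (D / p) :=
    mul_le_mul_of_nonneg_left hΦ' (by linarith)
  have h6 : 0 ≤ (1 + 2 * η - m / 2 + (m + 2 * η) / p) * D := by
    have : (m + 2 * η) * (D / p) = (m + 2 * η) / p * D := by ring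
    linarith
  have hDz : D = 0 := by
    by_contra hne
    have : 0 < D := lt_of_le_of_ne hD0 (Ne.symm hne)
    nlinarith
  exact H.eq_zero_of_integral_norm_gradient_sq_eq_zero μ S hgi hDz x

end IsRadialField

end

/-! ### Projection to the foot of the normal, by the implicit function theorem. -/

section

open scoped ContDiff Topology
open Set Filter

section LocalProjection

variable {E : Type*} [NormedAddCommGroup E] [InnerProductSpace ℝ E] [FiniteDimensional ℝ E]

theorem isInvertible_of_injective {A : E →L[ℝ] E} (hA : Function.Injective A) :
    A.IsInvertible :=
  ⟨(LinearEquiv.ofInjectiveEndo (A : E →ₗ[ℝ] E) hA).toContinuousLinearEquiv, by ext; rfl⟩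

/-- The adjoint on a real inner product space, as a continuous linear map. -/
noncomputable def adjointMap : (E →L[ℝ] E) →L[ℝ] (E →L[ℝ] E) :=
  LinearMap.toContinuousLinearMap
    { toFun := fun A => ContinuousLinearMap.adjoint A
      map_add' := fun A B => map_add _ A B
      map_smul' := fun c A => by simp }

theorem adjointMap_inner_left (A : E →L[ℝ] E) (x y : E) :
    inner ℝ (adjointMap A x) y = inner ℝ x (A y) :=
  ContinuousLinearMap.adjoint_inner_left A y x

/-- Nearest point projection near a point of the image of a subspace `W` under a local
diffeomorphism `g`, characterised by orthogonality to the tangent directions. -/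
theorem exists_local_projection (W : Submodule ℝ E) {g : E → E} {y₀ : E}
    (hg : ContDiffAt ℝ 2 g y₀) (hinj : Function.Injective (fderiv ℝ g y₀)) (hy₀ : y₀ ∈ W) :
    ∃ π : E → E, ContDiffAt ℝ 1 π (g y₀) ∧
      fderiv ℝ π (g y₀) = (W.map (fderiv ℝ g y₀ : E →ₗ[ℝ] E)).starProjection ∧
      ∀ᶠ v : E × E in 𝓝 (g y₀, y₀), v.2 ∈ W →
        (∀ w ∈ W, inner ℝ (v.1 - g v.2) (fderiv ℝ g v.2 w) = 0) → π v.1 = g v.2 := by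
  let P : E →L[ℝ] E := W.starProjection
  have hPmem : ∀ v, P v ∈ W := fun v => W.starProjection_apply_mem v
  have hPself : ∀ v ∈ W, P v = v := fun v hv => W.starProjection_eq_self_iff.2 hv
  let u₀ : E × E := (g y₀, y₀)
  let c : E × E → E →L[ℝ] E := fun v => adjointMap ((fderiv ℝ g v.2).comp P)
  -- The first summand lies in `W`, the second in its orthogonal complement. So `G(z, y) = 0`
  -- encodes both `y ∈ W` and orthogonality of `z - g y` to the tangent directions; solving for `y =
  -- ψ z` gives `π = g ∘ ψ`.
  let G : E × E → E := fun v => c v (v.1 - g v.2) - (v.2 - P v.2)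
  have hgu : ContDiffAt ℝ 2 (fun v : E × E => g v.2) u₀ :=
    ContDiffAt.comp u₀ (f := Prod.snd) (g := g) hg contDiffAt_snd
  have hdg : ContDiffAt ℝ 1 (fderiv ℝ g) y₀ := hg.fderiv_right (by norm_num)
  have hdgu : ContDiffAt ℝ 1 (fun v : E × E => fderiv ℝ g v.2) u₀ :=
    ContDiffAt.comp u₀ (f := Prod.snd) (g := fderiv ℝ g) hdg contDiffAt_snd
  have hc : ContDiffAt ℝ 1 c u₀ :=
    (ContinuousLinearMap.contDiff (adjointMap (E := E))).contDiffAt.comp u₀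
      (f := fun v : E × E => (fderiv ℝ g v.2).comp P) (hdgu.clm_comp contDiffAt_const)
  have hw : ContDiffAt ℝ 1 (fun v : E × E => v.1 - g v.2) u₀ :=
    contDiffAt_fst.sub (hgu.of_le (by norm_num))
  have hG : ContDiffAt ℝ 1 G u₀ :=
    (hc.clm_apply hw).sub (contDiffAt_snd.sub (P.contDiff.contDiffAt.comp u₀ contDiffAt_snd))
  set A := fderiv ℝ g y₀ with hA
  set B := A.comp P with hB
  have hG' : ∀ a b : E, fderiv ℝ G u₀ (a, b) = adjointMap B (a - A b) - (b - P b) := by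
    intro a b
    have h1 : HasFDerivAt g A y₀ := (hg.differentiableAt two_ne_zero).hasFDerivAt
    have h2 : HasFDerivAt (fun v : E × E => v.1 - g v.2)
        (ContinuousLinearMap.fst ℝ E E - A.comp (ContinuousLinearMap.snd ℝ E E)) u₀ :=
      hasFDerivAt_fst.sub (HasFDerivAt.comp u₀ (f := Prod.snd) (g := g) h1 hasFDerivAt_snd)
    have h3 := (hc.differentiableAt one_ne_zero).hasFDerivAt.clm_apply h2
    have h4 : HasFDerivAt (fun v : E × E => v.2 - P v.2)
        (ContinuousLinearMap.snd ℝ E E - P.comp (ContinuousLinearMap.snd ℝ E E)) u₀ :=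
      hasFDerivAt_snd.sub (P.hasFDerivAt.comp u₀ hasFDerivAt_snd)
    have h5 : HasFDerivAt G _ u₀ := h3.sub h4
    rw [h5.fderiv]
    simp [u₀, c, hB, hA]
  have hPadj : ∀ v, P (adjointMap B v) = adjointMap B v := by
    intro v
    refine ext_inner_right ℝ fun w => ?_
    rw [show inner ℝ (P (adjointMap B v)) w = inner ℝ (adjointMap B v) (P w) from
      W.inner_starProjection_left_eq_right _ _, adjointMap_inner_left, adjointMap_inner_left]
    simp only [hB, ContinuousLinearMap.comp_apply]
    rw [hPself _ (hPmem w)]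
  have hsplit : ∀ a b : E, fderiv ℝ G u₀ (a, b) = 0 → P b = b ∧ adjointMap B (a - A b) = 0 := by
    intro a b hab
    rw [hG'] at hab
    have h1 : P (adjointMap B (a - A b) - (b - P b)) = 0 := by rw [hab, map_zero]
    rw [map_sub P (adjointMap B (a - A b)), hPadj, map_sub P b, hPself _ (hPmem b), sub_self,
      sub_zero] at h1
    rw [h1, zero_sub, neg_eq_zero, sub_eq_zero] at hab
    exact ⟨hab.symm, h1⟩
  -- A kernel vector `b` lies in `W` and satisfies `|A b|² = 0`, so `b = 0`.
  have hinv : (fderiv ℝ G u₀ ∘L ContinuousLinearMap.inr ℝ E E).IsInvertible := by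
    refine isInvertible_of_injective ((injective_iff_map_eq_zero _).2 fun b hb => ?_)
    have hb' : fderiv ℝ G u₀ (0, b) = 0 := hb
    obtain ⟨h1, h2⟩ := hsplit 0 b hb'
    have h3 : inner ℝ (adjointMap B (0 - A b)) b = -inner ℝ (A b) (A b) := by
      rw [adjointMap_inner_left, zero_sub, inner_neg_left, hB, ContinuousLinearMap.comp_apply, h1]
    rw [h2, inner_zero_left, eq_comm, neg_eq_zero, inner_self_eq_zero] at h3
    exact hinj (h3.trans (map_zero A).symm)
  let ψ := hG.implicitFunction one_ne_zero hinv
  have hψ : ContDiffAt ℝ 1 ψ (g y₀) := hG.contDiffAt_implicitFunction one_ne_zero hinv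
  have hψ0 : ψ (g y₀) = y₀ := hG.implicitFunction_apply_self one_ne_zero hinv
  have hgψ : ContDiffAt ℝ 1 g (ψ (g y₀)) := by rw [hψ0]; exact hg.of_le (by norm_num)
  have hG0 : G u₀ = 0 := by simp [G, u₀, hPself y₀ hy₀]
  refine ⟨fun z => g (ψ z), hgψ.comp _ hψ, ?_, ?_⟩
  · have hψd := (hψ.differentiableAt one_ne_zero).hasFDerivAt
    have hgd : HasFDerivAt g A (ψ (g y₀)) := by
      rw [hψ0]; exact (hg.differentiableAt two_ne_zero).hasFDerivAt
    have hcomp := hgd.comp (g y₀) hψd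
    have hfd : fderiv ℝ (fun z => g (ψ z)) (g y₀) = A.comp (fderiv ℝ ψ (g y₀)) := hcomp.fderiv
    rw [hfd]
    have hGd : HasFDerivAt G (fderiv ℝ G u₀) (g y₀, ψ (g y₀)) := by
      rw [hψ0]; exact (hG.differentiableAt one_ne_zero).hasFDerivAt
    -- Differentiating `G (z, ψ z) = G u₀` and splitting along `W` gives the two properties that
    -- characterise the orthogonal projection onto `A W`.
    have hzero : ∀ a, fderiv ℝ G u₀ (a, fderiv ℝ ψ (g y₀) a) = 0 := by
      intro a
      have h1 := hGd.comp (g y₀) ((hasFDerivAt_id (g y₀)).prodMk hψd)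
      have h2 : (fun z => G (z, ψ z)) =ᶠ[𝓝 (g y₀)] fun _ => G u₀ :=
        hG.eventually_apply_implicitFunction one_ne_zero hinv
      have h3 := h1.unique ((hasFDerivAt_const (G u₀) (g y₀)).congr_of_eventuallyEq h2)
      have h4 := congrArg (fun L : E →L[ℝ] E => L a) h3
      simpa using h4
    ext1 a
    obtain ⟨h1, h2⟩ := hsplit _ _ (hzero a)
    refine (Submodule.eq_starProjection_of_mem_of_inner_eq_zero ?_ ?_).symm
    · exact ⟨fderiv ℝ ψ (g y₀) a, h1 ▸ hPmem _, rfl⟩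
    · rintro _ ⟨w, hwW, rfl⟩
      have : A w = B w := by rw [hB, ContinuousLinearMap.comp_apply, hPself w hwW]
      show inner ℝ (a - A (fderiv ℝ ψ (g y₀) a)) (A w) = 0
      rw [this, ← adjointMap_inner_left, h2, inner_zero_left]
  · filter_upwards [hG.eventually_apply_eq_iff_implicitFunction one_ne_zero hinv] with v hv hvW hperp
    have : G v = G u₀ := by
      rw [hG0]
      have h1 : c v (v.1 - g v.2) = 0 := by
        refine ext_inner_right ℝ fun w => ?_
        rw [adjointMap_inner_left, inner_zero_left]
        exact hperp _ (hPmem w)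
      simp only [G, h1, hPself _ hvW, sub_self]
    show g (ψ v.1) = g v.2
    exact congrArg g (hv.1 this)

end LocalProjection

end

/-! ### Charts, tangent spaces and local projections. -/

section

open scoped ContDiff Topology
open Set Filter

section Charts

/-- The coordinate subspace `ℝᵏ × {0}` of `ℝⁿ`, as a submodule. -/
def flatSubmodule (n k : ℕ) : Submodule ℝ (EuclideanSpace ℝ (Fin n)) where
  carrier := flatModel n k
  zero_mem' := fun _ _ => rfl
  add_mem' := fun ha hb i hi => by simp [ha i hi, hb i hi]
  smul_mem' := fun c a ha i hi => by simp [ha i hi]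

theorem finrank_flatSubmodule {n k : ℕ} (hkn : k ≤ n) :
    Module.finrank ℝ (flatSubmodule n k) = k := by
  let L : flatSubmodule n k →ₗ[ℝ] (Fin k → ℝ) :=
    { toFun := fun y j => y.1 (Fin.castLE hkn j)
      map_add' := fun _ _ => rfl
      map_smul' := fun _ _ => rfl }
  have hL : Function.Bijective L := by
    constructor
    · refine (injective_iff_map_eq_zero L).2 fun y hy => ?_
      ext i
      by_cases hi : (i : ℕ) < k
      · exact congrFun hy ⟨i, hi⟩
      · exact y.2 i (not_lt.1 hi)
    · intro c
      refine ⟨⟨WithLp.toLp 2 fun i : Fin n => if hi : (i : ℕ) < k then c ⟨i, hi⟩ else 0,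
        fun i hi => by simp [not_lt.2 hi]⟩, ?_⟩
      ext j
      exact dif_pos j.2
  rw [(LinearEquiv.ofBijective L hL).finrank_eq, Module.finrank_fin_fun]

variable {n k : ℕ} {Γ : Set (EuclideanSpace ℝ (Fin n))}

/-- The image under a chart of a vector which points into the model half-space is tangent. -/
theorem fderiv_symm_mem_tangentConeAt
    {Φ : OpenPartialHomeomorph (EuclideanSpace ℝ (Fin n)) (EuclideanSpace ℝ (Fin n))}
    (hΦ : ContDiffOn ℝ ∞ Φ.symm Φ.target)
    (hmodel : (∀ y ∈ Φ.source, y ∈ Γ ↔ Φ y ∈ flatModel n k) ∨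
      (∀ y ∈ Φ.source, y ∈ Γ ↔ Φ y ∈ flatHalfModel n k))
    {x : EuclideanSpace ℝ (Fin n)} (hx : x ∈ Φ.source) (hxΓ : x ∈ Γ)
    {w : EuclideanSpace ℝ (Fin n)} (hw : w ∈ flatSubmodule n k)
    (hw0 : ∀ i : Fin n, (i : ℕ) = 0 → 0 ≤ w i) :
    fderiv ℝ Φ.symm (Φ x) w ∈ tangentConeAt ℝ Γ x := by
  have hy : Φ x ∈ Φ.target := Φ.map_source hx
  have hd : HasFDerivAt Φ.symm (fderiv ℝ Φ.symm (Φ x)) (Φ x) :=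
    ((hΦ.contDiffAt (Φ.open_target.mem_nhds hy)).differentiableAt (by simp)).hasFDerivAt
  have hcone : w ∈ tangentConeAt ℝ (Φ.symm ⁻¹' Γ) (Φ x) := by
    refine mem_tangentConeAt_of_add_smul_mem (l := 𝓝[>] (0 : ℝ)) (c := id) ?_ ?_
    · exact tendsto_id'.2 (nhdsWithin_mono _ fun t ht => ne_of_gt ht)
    · have hcont : ContinuousAt (fun t : ℝ => Φ x + t • w) 0 := by fun_prop
      have hev : ∀ᶠ t : ℝ in 𝓝[>] 0, Φ x + t • w ∈ Φ.target :=
        nhdsWithin_le_nhds (hcont.preimage_mem_nhds (Φ.open_target.mem_nhds (by simpa using hy)))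
      filter_upwards [hev, self_mem_nhdsWithin] with t ht ht0
      have ht0' : (0 : ℝ) < t := ht0
      show Φ.symm (Φ x + t • w) ∈ Γ
      rcases hmodel with hm | hm
      · rw [hm _ (Φ.map_target ht), Φ.right_inv ht]
        exact (flatSubmodule n k).add_mem ((hm x hx).1 hxΓ) ((flatSubmodule n k).smul_mem t hw)
      · rw [hm _ (Φ.map_target ht), Φ.right_inv ht]
        obtain ⟨h1, h2⟩ := (hm x hx).1 hxΓ
        refine ⟨(flatSubmodule n k).add_mem h1 ((flatSubmodule n k).smul_mem t hw), fun i hi => ?_⟩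
        have := h2 i hi
        have := hw0 i hi
        simp only [PiLp.add_apply, PiLp.smul_apply, smul_eq_mul]
        positivity
  have h1 := hd.hasFDerivWithinAt.mapsTo_tangent_cone (s := Φ.symm ⁻¹' Γ) hcone
  rw [Φ.left_inv hx] at h1
  exact tangentConeAt_mono (image_preimage_subset _ _) h1

/-- At a boundary point the tangent cone may contain only inward vectors, but one of `w` and `-w` is
inward, and the span contains both. -/
theorem fderiv_symm_mem_tangentSpaceAt
    {Φ : OpenPartialHomeomorph (EuclideanSpace ℝ (Fin n)) (EuclideanSpace ℝ (Fin n))}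
    (hΦ : ContDiffOn ℝ ∞ Φ.symm Φ.target)
    (hmodel : (∀ y ∈ Φ.source, y ∈ Γ ↔ Φ y ∈ flatModel n k) ∨
      (∀ y ∈ Φ.source, y ∈ Γ ↔ Φ y ∈ flatHalfModel n k))
    {x : EuclideanSpace ℝ (Fin n)} (hx : x ∈ Φ.source) (hxΓ : x ∈ Γ)
    {w : EuclideanSpace ℝ (Fin n)} (hw : w ∈ flatSubmodule n k) :
    fderiv ℝ Φ.symm (Φ x) w ∈ tangentSpaceAt Γ x := by
  by_cases hw0 : ∀ i : Fin n, (i : ℕ) = 0 → 0 ≤ w i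
  · exact Submodule.subset_span (fderiv_symm_mem_tangentConeAt hΦ hmodel hx hxΓ hw hw0)
  · push Not at hw0
    obtain ⟨j, hj, hwj⟩ := hw0
    have h1 : fderiv ℝ Φ.symm (Φ x) (-w) ∈ tangentSpaceAt Γ x :=
      Submodule.subset_span (fderiv_symm_mem_tangentConeAt hΦ hmodel hx hxΓ
        ((flatSubmodule n k).neg_mem hw) fun i hi => by
          have : i = j := Fin.ext (hi.trans hj.symm)
          subst this
          simpa using hwj.le)
    rw [map_neg] at h1
    simpa using (tangentSpaceAt Γ x).neg_mem h1

/-- `π` is, on `U`, the projection to the foot of the normals of `Γ`, and its derivative is close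
to an orthogonal projection of rank `k`. -/
structure IsLocalProjection (k : ℕ) (η : ℝ) (Γ U : Set (EuclideanSpace ℝ (Fin n)))
    (π : EuclideanSpace ℝ (Fin n) → EuclideanSpace ℝ (Fin n)) : Prop where
  contDiffAt : ∀ z ∈ U, ContDiffAt ℝ 1 π z
  eq_foot : ∀ z ∈ U, ∀ x ∈ U, x ∈ Γ → z - x ∈ normalSpaceAt Γ x → π z = x
  norm_fderiv_le : ∀ z ∈ U, ‖fderiv ℝ π z‖ ≤ 2
  inner_le : ∀ z ∈ U, ∀ v, inner ℝ (v - fderiv ℝ π z v) v ≤ (1 + η) * ‖v‖ ^ 2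
  trace_le : ∀ z ∈ U, |LinearMap.trace ℝ (EuclideanSpace ℝ (Fin n)) (fderiv ℝ π z) - k| ≤ η

theorem IsLocalProjection.mono {η : ℝ} {U V : Set (EuclideanSpace ℝ (Fin n))}
    {π : EuclideanSpace ℝ (Fin n) → EuclideanSpace ℝ (Fin n)}
    (h : IsLocalProjection k η Γ U π) (hVU : V ⊆ U) : IsLocalProjection k η Γ V π :=
  ⟨fun z hz => h.contDiffAt z (hVU hz), fun z hz x hx => h.eq_foot z (hVU hz) x (hVU hx),
    fun z hz => h.norm_fderiv_le z (hVU hz), fun z hz => h.inner_le z (hVU hz),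
    fun z hz => h.trace_le z (hVU hz)⟩

/-- At `x₀` the derivative of `π` is an exact orthogonal projection of rank `k`; continuity gives
the `η`-bounds nearby. Boundary points need no separate treatment: `π` projects to the image of the
full flat space, which contains `Γ` locally, and normals to `Γ` are orthogonal to that image. -/
theorem exists_isLocalProjection (hkn : k ≤ n) (hΓ : IsSmoothSubmanifold n k Γ) {η : ℝ}
    (hη : 0 < η) {x₀ : EuclideanSpace ℝ (Fin n)} (hx₀ : x₀ ∈ Γ) :
    ∃ r > 0, ∃ π, IsLocalProjection k η Γ (Metric.ball x₀ r) π := by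
  obtain ⟨Φ, hxs, hΦ, hΦs, hmodel⟩ := hΓ x₀ hx₀
  have hyt : Φ x₀ ∈ Φ.target := Φ.map_source hxs
  have hg : ContDiffAt ℝ ∞ Φ.symm (Φ x₀) := hΦs.contDiffAt (Φ.open_target.mem_nhds hyt)
  have hflat : ∀ x ∈ Φ.source, x ∈ Γ → Φ x ∈ flatSubmodule n k := by
    intro x hx hxΓ
    rcases hmodel with hm | hm
    · exact (hm x hx).1 hxΓ
    · exact ((hm x hx).1 hxΓ).1
  have hinj : Function.Injective (fderiv ℝ Φ.symm (Φ x₀)) := by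
    have h1 : HasFDerivAt Φ.symm (fderiv ℝ Φ.symm (Φ x₀)) (Φ x₀) :=
      (hg.differentiableAt (by simp)).hasFDerivAt
    have h2 : HasFDerivAt Φ (fderiv ℝ Φ x₀) (Φ.symm (Φ x₀)) := by
      rw [Φ.left_inv hxs]
      exact ((hΦ.contDiffAt (Φ.open_source.mem_nhds hxs)).differentiableAt (by simp)).hasFDerivAt
    have h3 : HasFDerivAt (fun y => y) ((fderiv ℝ Φ x₀).comp (fderiv ℝ Φ.symm (Φ x₀))) (Φ x₀) := by
      refine (h2.comp (Φ x₀) h1).congr_of_eventuallyEq ?_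
      filter_upwards [Φ.open_target.mem_nhds hyt] with y hy
      exact (Φ.right_inv hy).symm
    have h4 := h3.unique (hasFDerivAt_id (Φ x₀))
    intro v w hvw
    have h5 := congrArg (fderiv ℝ Φ x₀) hvw
    have h6 : ∀ v, fderiv ℝ Φ x₀ (fderiv ℝ Φ.symm (Φ x₀) v) = v := fun v =>
      congrArg (fun L : EuclideanSpace ℝ (Fin n) →L[ℝ] EuclideanSpace ℝ (Fin n) => L v) h4
    rwa [h6, h6] at h5
  obtain ⟨π, hπ, hπd, hπev⟩ := exists_local_projection (flatSubmodule n k)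
    (hg.of_le (WithTop.coe_le_coe.2 (le_top : (2 : ℕ∞) ≤ ⊤))) hinj (hflat x₀ hxs hx₀)
  rw [Φ.left_inv hxs] at hπ hπd hπev
  set T := (flatSubmodule n k).map (fderiv ℝ Φ.symm (Φ x₀) :
    EuclideanSpace ℝ (Fin n) →ₗ[ℝ] EuclideanSpace ℝ (Fin n)) with hT
  replace hπd : fderiv ℝ π x₀ = T.starProjection := hπd
  have hTk : Module.finrank ℝ T = k := by
    rw [← finrank_flatSubmodule hkn]
    exact (Submodule.equivMapOfInjective _ hinj (flatSubmodule n k)).finrank_eq.symm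
  have htr : LinearMap.trace ℝ _ (T.starProjection : EuclideanSpace ℝ (Fin n) →ₗ[ℝ] _) = k := by
    have : LinearMap.IsProj T (T.starProjection : EuclideanSpace ℝ (Fin n) →ₗ[ℝ] _) :=
      ⟨fun v => T.starProjection_apply_mem v, fun v hv => T.starProjection_eq_self_iff.2 hv⟩
    rw [this.trace, hTk]
  have htrc : Continuous fun L : EuclideanSpace ℝ (Fin n) →L[ℝ] EuclideanSpace ℝ (Fin n) =>
      LinearMap.trace ℝ _ (L : EuclideanSpace ℝ (Fin n) →ₗ[ℝ] _) :=
    LinearMap.continuous_of_finiteDimensional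
      ((LinearMap.trace ℝ (EuclideanSpace ℝ (Fin n))).comp (ContinuousLinearMap.coeLM ℝ))
  have hdc : ContinuousAt (fderiv ℝ π) x₀ :=
    (hπ.fderiv_right (m := 0) (by norm_num)).continuousAt
  have e1 : ∀ᶠ z in 𝓝 x₀, ContDiffAt ℝ 1 π z := hπ.eventually (by simp)
  -- The bound `1` yields `‖fderiv ℝ π z‖ ≤ 2`; the bound `η` yields the estimate of the quadratic
  -- form.
  have e2 : ∀ᶠ z in 𝓝 x₀, ‖fderiv ℝ π z - T.starProjection‖ ≤ min 1 η := by
    have h1 := (hdc.sub continuousAt_const).norm (f := fun z => fderiv ℝ π z - T.starProjection)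
    refine h1.eventually_le_const ?_
    simpa [hπd] using hη
  have e3 : ∀ᶠ z in 𝓝 x₀, |LinearMap.trace ℝ _ (fderiv ℝ π z :
      EuclideanSpace ℝ (Fin n) →ₗ[ℝ] _) - k| ≤ η := by
    have h1 : ContinuousAt (fun z => |LinearMap.trace ℝ _ (fderiv ℝ π z :
      EuclideanSpace ℝ (Fin n) →ₗ[ℝ] _) - k|) x₀ :=
      ((htrc.continuousAt.comp hdc).sub continuousAt_const).abs
    refine h1.eventually_le_const ?_
    show |LinearMap.trace ℝ (EuclideanSpace ℝ (Fin n)) (fderiv ℝ π x₀) - k| < η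
    rw [hπd, htr]
    simpa using hη
  have e4 : ∀ᶠ x in 𝓝 x₀, x ∈ Φ.source := Φ.open_source.mem_nhds hxs
  have e5 : ∀ᶠ v : EuclideanSpace ℝ (Fin n) × EuclideanSpace ℝ (Fin n) in 𝓝 (x₀, x₀),
      Φ v.2 ∈ flatSubmodule n k →
        (∀ w ∈ flatSubmodule n k, inner ℝ (v.1 - Φ.symm (Φ v.2)) (fderiv ℝ Φ.symm (Φ v.2) w) = 0) →
        π v.1 = Φ.symm (Φ v.2) := by
    have hc : ContinuousAt (fun v : EuclideanSpace ℝ (Fin n) × EuclideanSpace ℝ (Fin n) =>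
        (v.1, Φ v.2)) (x₀, x₀) :=
      continuousAt_fst.prodMk (ContinuousAt.comp (f := Prod.snd) (x := (x₀, x₀))
        (Φ.continuousAt hxs) continuousAt_snd)
    exact hc.eventually hπev
  obtain ⟨r₁, hr₁, h₁⟩ := Metric.eventually_nhds_iff.1 (e1.and (e2.and (e3.and e4)))
  obtain ⟨r₂, hr₂, h₂⟩ := Metric.eventually_nhds_iff.1 e5
  refine ⟨min r₁ r₂, lt_min hr₁ hr₂, π, ?_⟩
  have hb1 : ∀ z ∈ Metric.ball x₀ (min r₁ r₂), dist z x₀ < r₁ := fun z hz =>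
    (Metric.mem_ball.1 hz).trans_le (min_le_left _ _)
  have hb2 : ∀ z ∈ Metric.ball x₀ (min r₁ r₂), dist z x₀ < r₂ := fun z hz =>
    (Metric.mem_ball.1 hz).trans_le (min_le_right _ _)
  refine ⟨fun z hz => (h₁ (hb1 z hz)).1, fun z hz x hx hxΓ hzx => ?_, fun z hz => ?_,
    fun z hz v => ?_, fun z hz => (h₁ (hb1 z hz)).2.2.1⟩
  · have hxs' : x ∈ Φ.source := (h₁ (hb1 x hx)).2.2.2
    have h3 := @h₂ (z, x) (by rw [Prod.dist_eq]; exact max_lt (hb2 z hz) (hb2 x hx))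
      (hflat x hxs' hxΓ)
    simp only [Φ.left_inv hxs'] at h3
    exact h3 fun w hw => Submodule.inner_left_of_mem_orthogonal
      (fderiv_symm_mem_tangentSpaceAt hΦs hmodel hxs' hxΓ hw) hzx
  · have h3 := (h₁ (hb1 z hz)).2.1
    have h4 : ‖T.starProjection‖ ≤ 1 := T.starProjection_norm_le
    have h5 := norm_le_norm_add_norm_sub' (fderiv ℝ π z) T.starProjection
    have h6 := min_le_left 1 η
    linarith
  · have h3 := (h₁ (hb1 z hz)).2.1.trans (min_le_right _ _)
    have h4 : inner ℝ (v - fderiv ℝ π z v) v = ‖v‖ ^ 2 - inner ℝ (T.starProjection v) v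
        - inner ℝ ((fderiv ℝ π z - T.starProjection) v) v := by
      rw [sub_apply, inner_sub_left, inner_sub_left,
        real_inner_self_eq_norm_sq]
      ring
    have h5 : 0 ≤ inner ℝ (T.starProjection v) v := T.re_inner_starProjection_nonneg v
    have h6 : |inner ℝ ((fderiv ℝ π z - T.starProjection) v) v| ≤ η * ‖v‖ ^ 2 := by
      refine (abs_real_inner_le_norm _ _).trans ?_
      rw [sq, ← mul_assoc]
      gcongr
      exact ContinuousLinearMap.le_of_opNorm_le _ h3 v
    have h7 := (abs_le.1 h6).1
    rw [h4]
    linarith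

end Charts

end

/-! ### The radial field in a thin tube. -/

section

open scoped ContDiff Topology
open Set Filter

section Tube

variable {n k : ℕ} {Γ : Set (EuclideanSpace ℝ (Fin n))}

theorem exists_uniform_isLocalProjection (hkn : k ≤ n) (hΓ : IsCompact Γ)
    (hΓk : IsSmoothSubmanifold n k Γ) {η : ℝ} (hη : 0 < η) :
    ∃ δ > 0, ∀ x ∈ Γ, ∃ π, IsLocalProjection k η Γ (Metric.ball x δ) π := by
  choose r hr π hπ using fun x : Γ => exists_isLocalProjection hkn hΓk hη x.2
  obtain ⟨δ, hδ, h⟩ := lebesgue_number_lemma_of_metric hΓ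
    (c := fun x : Γ => Metric.ball (x : EuclideanSpace ℝ (Fin n)) (r x))
    (fun _ => Metric.isOpen_ball)
    (fun x hx => mem_iUnion.2 ⟨⟨x, hx⟩, Metric.mem_ball_self (hr _)⟩)
  refine ⟨δ, hδ, fun x hx => ?_⟩
  obtain ⟨i, hi⟩ := h x hx
  exact ⟨π i, (hπ i).mono hi⟩

theorem surjective_one_sub_of_norm_lt_one {E : Type*} [NormedAddCommGroup E] [NormedSpace ℝ E]
    [CompleteSpace E] {A : E →L[ℝ] E} (hA : ‖A‖ < 1) :
    (1 - A : E →L[ℝ] E).range = ⊤ := by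
  obtain ⟨U, hU⟩ := isUnit_one_sub_of_norm_lt_one hA
  refine LinearMap.range_eq_top.2 fun y => ⟨(↑U⁻¹ : E →L[ℝ] E) y, ?_⟩
  have h1 : (↑U : E →L[ℝ] E) * ↑U⁻¹ = 1 := U.mul_inv
  have h2 := congrArg (fun L : E →L[ℝ] E => L y) h1
  rw [← hU]
  exact h2

/-- Thin tubes around a compact submanifold carry a radial field: the displacement from the
foot of the normal. -/
theorem exists_isRadialField (hkn : k ≤ n) (hΓ : IsCompact Γ)
    (hΓk : IsSmoothSubmanifold n k Γ) {η : ℝ} (hη : 0 < η) :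
    ∃ ε₀ > 0, ∀ ε : ℝ, 0 < ε → ε < ε₀ → ∃ h C t₀, 0 < C ∧
      IsRadialField (tubularDomain ε Γ) h C ((n : ℝ) - k) η t₀ := by
  obtain ⟨δ, hδ, hloc⟩ := exists_uniform_isLocalProjection hkn hΓ hΓk hη
  -- All points and feet that are compared lie within `3 ε < δ` of a given foot, and stretching a
  -- normal by at most `2` keeps its length below `δ / 2`.
  refine ⟨δ / 8, by positivity, fun ε hε hεδ => ?_⟩
  set S : Set (EuclideanSpace ℝ (Fin n)) :=
    ⋃ x ∈ Γ, {z | ∃ ξ ∈ normalSpaceAt Γ x, ‖ξ‖ < ε ∧ z = x + ξ} with hS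
  have hSmem : ∀ z, z ∈ S ↔ ∃ x ∈ Γ, z - x ∈ normalSpaceAt Γ x ∧ ‖z - x‖ < ε := by
    intro z
    simp only [hS, mem_iUnion, mem_ofPred_eq, exists_prop]
    constructor
    · rintro ⟨x, hx, ξ, hξ, hn, rfl⟩
      exact ⟨x, hx, by simpa using hξ, by simpa using hn⟩
    · rintro ⟨x, hx, h1, h2⟩
      exact ⟨x, hx, z - x, h1, h2, by abel⟩
  have hΩ : tubularDomain ε Γ = interior S := rfl
  set Ω := tubularDomain ε Γ with hΩdef
  have hΩo : IsOpen Ω := isOpen_interior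
  have hΩS : Ω ⊆ S := interior_subset
  choose! foot hfΓ hfN hfε using fun z (hz : z ∈ S) => (hSmem z).1 hz
  -- Two feet of normals through `z` at distance below `δ / 2` lie in one ball of radius `δ`, where
  -- both equal `π z`.
  have huniq : ∀ z, ∀ x ∈ Γ, ∀ x' ∈ Γ, z - x ∈ normalSpaceAt Γ x → z - x' ∈ normalSpaceAt Γ x' →
      ‖z - x‖ < δ / 2 → ‖z - x'‖ < δ / 2 → x = x' := by
    intro z x hx x' hx' hn hn' hd hd'
    obtain ⟨π, hπ⟩ := hloc x hx
    have hz : z ∈ Metric.ball x δ := by rw [mem_ball_iff_norm]; linarith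
    have hx'b : x' ∈ Metric.ball x δ := by
      rw [mem_ball_iff_norm]
      have : x' - x = (z - x) - (z - x') := by abel
      rw [this]
      exact (norm_sub_le _ _).trans_lt (by linarith)
    rw [← hπ.eq_foot z hz x (Metric.mem_ball_self hδ) hx hn, hπ.eq_foot z hz x' hx'b hx' hn']
  have hfoot : ∀ z ∈ S, ∀ x ∈ Γ, z - x ∈ normalSpaceAt Γ x → ‖z - x‖ < δ / 2 → foot z = x :=
    fun z hz x hx hn hd => huniq z _ (hfΓ z hz) x hx (hfN z hz) hn
      ((hfε z hz).trans (by linarith)) hd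
  have hlocal : ∀ z ∈ Ω, ∃ π, IsLocalProjection k η Γ (Metric.ball (foot z) δ) π ∧
      z ∈ Metric.ball (foot z) δ ∧
      (fun z => z - foot z) =ᶠ[𝓝 z] fun z => z - π z := by
    intro z hz
    obtain ⟨π, hπ⟩ := hloc (foot z) (hfΓ z (hΩS hz))
    have hz1 := hfε z (hΩS hz)
    refine ⟨π, hπ, by rw [mem_ball_iff_norm]; linarith, ?_⟩
    filter_upwards [hΩo.mem_nhds hz, Metric.ball_mem_nhds z hε] with w hw hwz
    rw [mem_ball_iff_norm] at hwz
    have hw1 := hfε w (hΩS hw)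
    have h1 : w ∈ Metric.ball (foot z) δ := by
      rw [mem_ball_iff_norm, show w - foot z = (w - z) + (z - foot z) by abel]
      exact (norm_add_le _ _).trans_lt (by linarith)
    have h2 : foot w ∈ Metric.ball (foot z) δ := by
      rw [mem_ball_iff_norm, show foot w - foot z = (w - z) + (z - foot z) - (w - foot w) by abel]
      refine (norm_sub_le _ _).trans_lt ?_
      have := norm_add_le (w - z) (z - foot z)
      linarith
    rw [hπ.eq_foot w h1 _ h2 (hfΓ w (hΩS hw)) (hfN w (hΩS hw))]
  have hcd : ∀ z ∈ Ω, ContDiffAt ℝ 1 (fun z => z - foot z) z := by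
    intro z hz
    obtain ⟨π, hπ, hzb, heq⟩ := hlocal z hz
    exact (contDiffAt_id.sub (hπ.contDiffAt z hzb)).congr_of_eventuallyEq heq
  have hfd : ∀ z ∈ Ω, ∃ π, IsLocalProjection k η Γ (Metric.ball (foot z) δ) π ∧
      z ∈ Metric.ball (foot z) δ ∧
      fderiv ℝ (fun z => z - foot z) z = 1 - fderiv ℝ π z := by
    intro z hz
    obtain ⟨π, hπ, hzb, heq⟩ := hlocal z hz
    refine ⟨π, hπ, hzb, heq.fderiv_eq.trans ?_⟩
    exact ((hasFDerivAt_id z).sub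
      ((hπ.contDiffAt z hzb).differentiableAt one_ne_zero).hasFDerivAt).fderiv
  have hnorm : ∀ z ∈ Ω, ‖fderiv ℝ (fun z => z - foot z) z‖ ≤ 3 := by
    intro z hz
    obtain ⟨π, hπ, hzb, heq⟩ := hfd z hz
    rw [heq]
    have h1 : ‖(1 : EuclideanSpace ℝ (Fin n) →L[ℝ] EuclideanSpace ℝ (Fin n))‖ ≤ 1 :=
      ContinuousLinearMap.norm_id_le
    refine (norm_sub_le _ _).trans ?_
    linarith [hπ.norm_fderiv_le z hzb]
  -- Moving along a normal does not change the foot, whence the scaling laws for `h`.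
  have hscale : ∀ z ∈ S, ∀ c : ℝ, |c| ≤ 2 → (foot z + c • (z - foot z)) ∈ S →
      foot (foot z + c • (z - foot z)) = foot z := by
    intro z hz c hc hmem
    refine hfoot _ hmem _ (hfΓ z hz) ?_ ?_
    · rw [add_sub_cancel_left]
      exact (normalSpaceAt Γ (foot z)).smul_mem c (hfN z hz)
    · rw [add_sub_cancel_left, norm_smul, Real.norm_eq_abs]
      have h1 : |c| * ‖z - foot z‖ ≤ 2 * ‖z - foot z‖ := by gcongr
      linarith [hfε z hz]
  have hcontr : ∀ (t : ℝ) (y : EuclideanSpace ℝ (Fin n)),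
      y - t • (y - foot y) = foot y + (1 - t) • (y - foot y) := fun t y => by module
  have hexp : ∀ (s : ℝ) (y : EuclideanSpace ℝ (Fin n)),
      y + s • (y - foot y) = foot y + (1 + s) • (y - foot y) := fun t y => by module
  have hcontrS : ∀ t : ℝ, 0 ≤ t → t ≤ 1 / 4 → ∀ y ∈ S, y - t • (y - foot y) ∈ S := by
    intro t ht0 ht y hy
    rw [hcontr, hSmem]
    refine ⟨foot y, hfΓ y hy, ?_, ?_⟩
    · rw [add_sub_cancel_left]
      exact (normalSpaceAt Γ (foot y)).smul_mem _ (hfN y hy)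
    · rw [add_sub_cancel_left, norm_smul, Real.norm_of_nonneg (by linarith)]
      exact (mul_le_of_le_one_left (norm_nonneg _) (by linarith)).trans_lt (hfε y hy)
  -- Here `3` bounds the derivative and `ε` the displacement itself; `t₀ = 1/4` makes `t ‖fderiv h‖
  -- ≤ 3/4 < 1`.
  refine ⟨fun z => z - foot z, 3 + ε, 1 / 4, by positivity, ?_⟩
  refine
    { isOpen := hΩo
      isBounded := ?_
      pos := by norm_num
      le_one := by norm_num
      contDiffOn := fun z hz => (hcd z hz).contDiffWithinAt
      norm_le := fun z hz => by linarith [hfε z (hΩS hz)]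
      norm_fderiv_le := fun z hz => by linarith [hnorm z hz]
      inner_le := ?_
      trace_le := ?_
      contract_mem := ?_
      contract := ?_
      expand := ?_ }
  · refine (hΓ.isBounded.thickening (δ := ε)).subset fun z hz => ?_
    rw [Metric.mem_thickening_iff]
    exact ⟨foot z, hfΓ z (hΩS hz), by rw [dist_eq_norm]; exact hfε z (hΩS hz)⟩
  · intro z hz v
    obtain ⟨π, hπ, hzb, heq⟩ := hfd z hz
    rw [heq]
    exact hπ.inner_le z hzb v
  · intro z hz
    obtain ⟨π, hπ, hzb, heq⟩ := hfd z hz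
    rw [heq]
    have h1 : LinearMap.trace ℝ (EuclideanSpace ℝ (Fin n))
        ((1 - fderiv ℝ π z : EuclideanSpace ℝ (Fin n) →L[ℝ] EuclideanSpace ℝ (Fin n)))
        = n - LinearMap.trace ℝ (EuclideanSpace ℝ (Fin n)) (fderiv ℝ π z) := by
      rw [ContinuousLinearMap.toLinearMap_sub, map_sub, ContinuousLinearMap.toLinearMap_one,
        LinearMap.trace_one, finrank_euclideanSpace_fin]
    rw [h1, show ∀ a b c : ℝ, a - b - (a - c) = -(b - c) by intros; ring, abs_neg]
    exact hπ.trace_le z hzb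
  · intro t ht0 ht y hy
    -- As `Ω` is an interior, more is needed than that contraction preserves `S`. Its derivative `1
    -- - t Dh` is onto, so it is open at `y` and carries a neighbourhood of `y` to a neighbourhood
    -- of the image inside `S`.
    rw [hΩ, mem_interior_iff_mem_nhds]
    have hd := ((contDiffAt_id (n := 1)).sub ((hcd y hy).const_smul t)).hasStrictFDerivAt
      one_ne_zero
    have hderiv : fderiv ℝ (fun z => z - t • (z - foot z)) y
        = 1 - t • fderiv ℝ (fun z => z - foot z) y :=
      ((hasFDerivAt_id y).sub (((hcd y hy).differentiableAt
        one_ne_zero).hasFDerivAt.const_smul t)).fderiv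
    have hsurj : (fderiv ℝ (fun z => z - t • (z - foot z)) y).range = ⊤ := by
      rw [hderiv]
      refine surjective_one_sub_of_norm_lt_one ?_
      rw [norm_smul, Real.norm_of_nonneg ht0]
      have := mul_le_mul ht (hnorm y hy) (norm_nonneg _) (by norm_num)
      linarith
    have hmap : map (fun z => z - t • (z - foot z)) (𝓝 y) = 𝓝 (y - t • (y - foot y)) :=
      HasStrictFDerivAt.map_nhds_eq_of_surj hd hsurj
    rw [← hmap]
    refine mem_of_superset (image_mem_map (hΩo.mem_nhds hy)) ?_
    rintro _ ⟨w, hw, rfl⟩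
    exact hcontrS t ht0 ht w (hΩS hw)
  · intro t ht0 ht y hy
    have h1 := hcontrS t ht0 ht y (hΩS hy)
    have h2 := hscale y (hΩS hy) (1 - t) (by rw [abs_of_nonneg] <;> linarith)
      (by rw [← hcontr]; exact h1)
    simp only [hcontr, h2, add_sub_cancel_left]
  · intro s hs0 hs z hz hmem
    have h2 := hscale z (hΩS hz) (1 + s) (by rw [abs_of_nonneg] <;> linarith)
      (by rw [← hexp]; exact hΩS hmem)
    simp only [hexp, h2, add_sub_cancel_left]

end Tube

end

/-! ### The Dirichlet problem and the choice of the error. -/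

section

open scoped ContDiff Topology
open Set Filter

section Dirichlet

variable {n : ℕ} {Ω : Set (EuclideanSpace ℝ (Fin n))} {f : ℝ → ℝ}
  {u : EuclideanSpace ℝ (Fin n) → ℝ}

theorem IsDirichletSolution.isZeroExtendedSolution (hu : IsDirichletSolution f Ω u)
    (hΩ : IsOpen Ω) : IsZeroExtendedSolution f Ω (Ω.indicator u) where
  continuous := continuous_indicator hu.boundary hu.continuousOn
  eq_zero := fun _ hx => indicator_of_notMem hx _
  contDiffOn := hu.contDiffOn.congr fun _ hx => indicator_of_mem hx _
  equation := fun x hx => by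
    have h : Ω.indicator u =ᶠ[𝓝 x] u := by
      filter_upwards [hΩ.mem_nhds hx] with z hz using indicator_of_mem hz _
    rw [(InnerProductSpace.laplacian_congr_nhds h).eq_of_nhds, h.eq_of_nhds]
    exact hu.equation x hx

theorem isDirichletSolution_of_eq_zero (hΩ : IsOpen Ω) (hf0 : f 0 = 0)
    (hu : ∀ x ∈ closure Ω, u x = 0) : IsDirichletSolution f Ω u where
  contDiffOn := contDiffOn_const.congr fun x hx => hu x (subset_closure hx)
  continuousOn := continuousOn_const.congr hu
  equation := fun x hx => by
    have h : u =ᶠ[𝓝 x] fun _ => 0 := by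
      filter_upwards [hΩ.mem_nhds hx] with z hz using hu z (subset_closure hz)
    rw [(InnerProductSpace.laplacian_congr_nhds h).eq_of_nhds, h.eq_of_nhds, hf0]
    simp
  boundary := fun x hx => hu x (frontier_subset_closure hx)

/-- Here `f` is nonpositive to the left of `0` and nonnegative to the right. The value `f 0 = 0` is
what makes the zero function a solution. -/
theorem eq_zero_of_mul_self_nonneg (hf : Continuous f) (h : ∀ t, 0 ≤ t * f t) : f 0 = 0 := by
  refine le_antisymm ?_ ?_
  · have h1 : Tendsto f (𝓝[<] 0) (𝓝 (f 0)) := hf.continuousAt.mono_left nhdsWithin_le_nhds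
    refine le_of_tendsto h1 ?_
    filter_upwards [self_mem_nhdsWithin] with t ht
    have ht' : t < 0 := ht
    nlinarith [h t]
  · have h1 : Tendsto f (𝓝[>] 0) (𝓝 (f 0)) := hf.continuousAt.mono_left nhdsWithin_le_nhds
    refine ge_of_tendsto h1 ?_
    filter_upwards [self_mem_nhdsWithin] with t ht
    have ht' : 0 < t := ht
    exact nonneg_of_mul_nonneg_right (h t) ht'

theorem exists_error_of_supercritical {m p : ℝ} (hm : 2 < m) (hp : 2 * m / (m - 2) < p) :
    0 < p ∧ ∃ η, 0 < η ∧ 2 * η ≤ m ∧ 1 + 2 * η - m / 2 + (m + 2 * η) / p < 0 := by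
  have hm2 : 0 < m - 2 := by linarith
  rw [div_lt_iff₀ hm2] at hp
  have hp0 : 2 < p := by
    by_contra hcon
    nlinarith
  refine ⟨by linarith, ?_⟩
  have hp' : 0 < p := by linarith
  have hg : 0 < m / 2 - 1 - m / p := by
    have : m / p < m / 2 - 1 := by
      rw [div_lt_iff₀ hp']; linarith
    linarith
  -- With `g = m/2 - 1 - m/p` and `p > 2`, the error `2η + 2η/p` is at most `3η ≤ 3g/4 < g`. The cap
  -- `1` ensures `2η ≤ 2 < m`.
  refine ⟨min 1 ((m / 2 - 1 - m / p) / 4), lt_min one_pos (by linarith), ?_, ?_⟩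
  · linarith [min_le_left 1 ((m / 2 - 1 - m / p) / 4)]
  · have h1 := min_le_right 1 ((m / 2 - 1 - m / p) / 4)
    have h0 : 0 < min 1 ((m / 2 - 1 - m / p) / 4) := lt_min one_pos (by linarith)
    generalize min 1 ((m / 2 - 1 - m / p) / 4) = η at h0 h1 ⊢
    have h2 : 2 * η / p ≤ η := by
      rw [div_le_iff₀ hp']; nlinarith
    rw [add_div]
    linarith

end Dirichlet

end

theorem theorem3p4 (n k : ℕ) (hk : 1 ≤ k) (hn : k + 2 < n)
    (Γ : Set (EuclideanSpace ℝ (Fin n))) (hΓ : IsCompact Γ) (hΓk : IsSmoothSubmanifold n k Γ)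
    (f : ℝ → ℝ) (hf : Continuous f)
    (p : ℝ) (hp : 2 * ((n : ℝ) - (k : ℝ)) / ((n : ℝ) - (k : ℝ) - 2) < p)
    (hfp : ∀ t : ℝ, p * (∫ τ in (0 : ℝ)..t, f τ) ≤ t * f t ∧ 0 ≤ p * ∫ τ in (0 : ℝ)..t, f τ) :
    ∃ ε₀ : ℝ, 0 < ε₀ ∧ ∀ ε : ℝ, 0 < ε → ε < ε₀ →
      ∀ u : EuclideanSpace ℝ (Fin n) → ℝ,
        IsDirichletSolution f (tubularDomain ε Γ) u ↔
          ∀ x ∈ closure (tubularDomain ε Γ), u x = 0 := by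
  have hm : (2 : ℝ) < (n : ℝ) - k := by
    have : ((k + 2 : ℕ) : ℝ) < n := by exact_mod_cast hn
    push_cast at this
    linarith
  obtain ⟨hp0, η, hη, hmη, hneg⟩ := exists_error_of_supercritical hm hp
  have hf0 : f 0 = 0 := eq_zero_of_mul_self_nonneg hf fun t => (hfp t).2.trans (hfp t).1
  obtain ⟨ε₀, hε₀, h⟩ := exists_isRadialField (by omega : k ≤ n) hΓ hΓk hη
  refine ⟨ε₀, hε₀, fun ε hε hεε₀ u => ?_⟩
  obtain ⟨v, C, t₀, hC, H⟩ := h ε hε hεε₀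
  refine ⟨fun hu x hx => ?_, fun hu => isDirichletSolution_of_eq_zero H.isOpen hf0 hu⟩
  by_cases hxΩ : x ∈ tubularDomain ε Γ
  · have : Nonempty (Fin n) := ⟨⟨0, by omega⟩⟩
    have hz := H.solution_eq_zero (hu.isZeroExtendedSolution H.isOpen) hf hC hη hmη hp0 hfp hneg x
    rwa [Set.indicator_of_mem hxΩ] at hz
  · refine hu.boundary x ⟨hx, ?_⟩
    rwa [H.isOpen.interior_eq]
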